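/- Let $\Omega\subset\mathbb C$ be a bounded domain, let $\varphi:\Omega\to\mathbb R$ be smooth, let $g:\Omega\to[0,\infty)$ be any nonnegative function, and put $\omega=\sqrt{-1}\,dz\wedge d\bar z$. For $a\in\Omega$ let $\Delta(a;r)=\{|z-a|<r\}$ and $\delta(a)=\sup\{r>0:\Delta(a;r)\subset\Omega\}$. For $0<r<\delta(a)$ define the $L^2$-extension index $$L_\varphi(a,r)=\frac{1}{\pi r^2K_{\Delta(a;r),\varphi}(a)},$$ where $$K_{\Delta(a;r),\varphi}(a)=\sup\Big\{|f(a)|^2e^{-\varphi(a)} : f\in\mathcal O(\Delta(a;r)),\ \int_{\Delta(a;r)}|f|^2e^{-\varphi}\le 1\Big\}$$ is the weighted Bergman kernel on the diagonal (measured in the metric $e^{-\varphi}$). For $a\in\Omega$ consider the two properties $(1)_a$ for every $\varepsilon>0$ there is $r_\varepsilon\in(0,\delta(a))$ such that $L_\varphi(a,r)\le e^{-\max\{(g(a)-\varepsilon)/2,\,0\}\,r^2}$ for all $r\in(0,r_\varepsilon)$; $(2)_a$ $\sqrt{-1}\,\partial\bar\partial\varphi(a)\ge g(a)\,\omega$,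 that is, $\dfrac{\partial^2\varphi}{\partial z\,\partial\bar z}(a)\ge g(a)$. Then: (i) for every $a\in\Omega$, $(1)_a$ implies $(2)_a$; (ii) for every $a\in\Omega$ such that $g(a)>0$ or $\sqrt{-1}\,\partial\bar\partial\varphi\ge 0$ on a neighbourhood of $a$, the properties $(1)_a$ and $(2)_a$ are equivalent; (iii) $(2)_a$ holds for all $a\in\Omega$ if and only if $(1)_a$ holds for all $a\in\Omega$. -/

import Mathlib

open Set MeasureTheory Filter
open scoped Topology ContDiff

noncomputable section

namespace L2Ext

/-- The Wirtinger derivative `∂f/∂z = (1/2) (∂f/∂x - i ∂f/∂y)`. -/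
def wirtinger (f : ℂ → ℂ) (z : ℂ) : ℂ :=
  (1 / 2) * (fderiv ℝ f z 1 - Complex.I * fderiv ℝ f z Complex.I)

/-- The Wirtinger derivative `∂f/∂z̄ = (1/2) (∂f/∂x + i ∂f/∂y)`. -/
def wirtingerBar (f : ℂ → ℂ) (z : ℂ) : ℂ :=
  (1 / 2) * (fderiv ℝ f z 1 + Complex.I * fderiv ℝ f z Complex.I)

/-- The coefficient `∂²φ/∂z∂z̄` of `i∂∂̄φ = (∂²φ/∂z∂z̄) i dz ∧ dz̄`. It is a real number when
`φ` is real valued and smooth near `z`. -/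
def leviCoeff (φ : ℂ → ℝ) (z : ℂ) : ℝ :=
  (wirtinger (wirtingerBar fun w => (φ w : ℂ)) z).re

/-- `i∂∂̄φ(a) ≥ c ω` as real `(1,1)`-forms at `a`, where `ω = i dz ∧ dz̄`. -/
def CurvatureGE (φ : ℂ → ℝ) (a : ℂ) (c : ℝ) : Prop :=
  c ≤ leviCoeff φ a

/-- The weighted Bergman space `A²(D, φ)`: functions holomorphic on `D` with
`∫_D |f|² e^{-φ} < ∞` (`D` open). -/
def bergmanSpace (D : Set ℂ) (φ : ℂ → ℝ) : Set (ℂ → ℂ) :=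
  {f | DifferentiableOn ℂ f D ∧ IntegrableOn (fun z => ‖f z‖ ^ 2 * Real.exp (-φ z)) D}

/-- `∫_D |f|² e^{-φ}`, with respect to Lebesgue measure. -/
def normSq (D : Set ℂ) (φ : ℂ → ℝ) (f : ℂ → ℂ) : ℝ :=
  ∫ z in D, ‖f z‖ ^ 2 * Real.exp (-φ z)

/-- The weighted Bergman kernel of `D` on the diagonal, measured in the metric `e^{-φ}`:
`K_{D,φ}(a) = sup { |f(a)|² e^{-φ(a)} | f ∈ A²(D, φ), ∫_D |f|² e^{-φ} ≤ 1 }`. -/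
def bergmanKernel (D : Set ℂ) (φ : ℂ → ℝ) (a : ℂ) : ℝ :=
  sSup {t : ℝ | ∃ f ∈ bergmanSpace D φ, normSq D φ f ≤ 1 ∧ t = ‖f a‖ ^ 2 * Real.exp (-φ a)}

/-- `δ(a) = sup { r > 0 | Δ(a; r) ⊆ Ω }`. -/
def maxRadius (Ω : Set ℂ) (a : ℂ) : ℝ :=
  sSup {r : ℝ | 0 < r ∧ Metric.ball a r ⊆ Ω}

/-- The `L²`-extension index `L_φ(a, r) = 1 / (π r² K_{Δ(a;r),φ}(a))`, meant for
`0 < r < δ(a)`. -/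
def extensionIndex (φ : ℂ → ℝ) (a : ℂ) (r : ℝ) : ℝ :=
  1 / (Real.pi * r ^ 2 * bergmanKernel (Metric.ball a r) φ a)

/-- For every `ε > 0` there is `r_ε ∈ (0, δ(a))` such that
`L_φ(a, r) ≤ exp (- max ((c - ε) / 2) 0 * r²)` for all `r ∈ (0, r_ε)`. -/
def SharpEstimate (Ω : Set ℂ) (φ : ℂ → ℝ) (a : ℂ) (c : ℝ) : Prop :=
  ∀ ε : ℝ, 0 < ε → ∃ rε ∈ Ioo 0 (maxRadius Ω a), ∀ r ∈ Ioo 0 rε,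
    extensionIndex φ a r ≤ Real.exp (-(max ((c - ε) / 2) 0) * r ^ 2)

end L2Ext

end

/-! Translate `a` to 0 and let λ be the value of ∂²φ/∂z∂z̄ there. By Taylor's formula φ = Re H +
λ|z|² + o(|z|²) with H holomorphic (`exists_holomorphic_taylor`). Multiplication by e^{-H/2} removes
Re H from the weight, so on small discs the extremal problem is close to that of the radial weight
λ|z|², where constants are optimal. This gives L(r) ≥ 1 - kr²/2 for every k > λ
(`exists_radius_upper`, from the mean value property) and, if λ > 0, L(r) ≤ 1 - kr²/2 + O(r⁴) for
every 0 < k < λ (`exists_radius_lower`, from the competitor e^{H/2}). Comparison with e^{-mr²}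
yields (1) ⇒ (2) always, and (2) ⇒ (1) when g(a) > 0.

If g(a) = 0 the claim is exactly L ≤ 1, which a second order expansion cannot decide when λ = 0. It
is the Ohsawa–Takegoshi theorem with optimal constant for a point in a disc (`sharp_extension`), and
it uses subharmonicity of φ near `a`. In (iii) this subharmonicity is automatic, because (2) is
assumed at all points and g ≥ 0.

The sharp extension is proved by duality. A twisted Bochner formula (`bochner_integral`) with a
logarithmic twist bounds ∫ e^φ δ/(|z|²+δ)² |β|² by a weighted norm of ∂̄β; as δ → 0 the left weight
tends to π times the Dirac mass at 0 (`dual_inequality`). Applied to β = θ + zv, where ∂̄θ = -z ·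
mollifier, this bounds below the distance in L²(e^φ) from the mollifier to the range of ∂̄
(`mollifier_dual_inequality`). Orthogonal projection turns the distance into a weakly holomorphic h
(`exists_weakly_holomorphic`), and convolution with the same mollifier makes it holomorphic with a
known value at 0. -/

noncomputable section

namespace L2Ext

open ComplexConjugate
open scoped Convolution

/-! ### Wirtinger derivatives: product rules, conjugation, vanishing integrals -/

section WirtingerCalculus

variable {f g : ℂ → ℂ} {z : ℂ}

theorem wirtinger_mul (hf : DifferentiableAt ℝ f z) (hg : DifferentiableAt ℝ g z) :
    wirtinger (fun w => f w * g w) z = wirtinger f z * g z + f z * wirtinger g z := by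
  simp only [wirtinger, fderiv_fun_mul hf hg, _root_.add_apply,
    _root_.smul_apply, smul_eq_mul]
  ring

theorem wirtingerBar_mul (hf : DifferentiableAt ℝ f z) (hg : DifferentiableAt ℝ g z) :
    wirtingerBar (fun w => f w * g w) z = wirtingerBar f z * g z + f z * wirtingerBar g z := by
  simp only [wirtingerBar, fderiv_fun_mul hf hg, _root_.add_apply,
    _root_.smul_apply, smul_eq_mul]
  ring

theorem wirtinger_add (hf : DifferentiableAt ℝ f z) (hg : DifferentiableAt ℝ g z) :
    wirtinger (fun w => f w + g w) z = wirtinger f z + wirtinger g z := by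
  simp only [wirtinger, fderiv_fun_add hf hg, _root_.add_apply]
  ring

theorem wirtingerBar_add (hf : DifferentiableAt ℝ f z) (hg : DifferentiableAt ℝ g z) :
    wirtingerBar (fun w => f w + g w) z = wirtingerBar f z + wirtingerBar g z := by
  simp only [wirtingerBar, fderiv_fun_add hf hg, _root_.add_apply]
  ring

theorem wirtingerBar_neg : wirtingerBar (fun w => -f w) z = -wirtingerBar f z := by
  simp only [wirtingerBar, fderiv_fun_neg, _root_.neg_apply]
  ring

theorem wirtingerBar_const_mul (c : ℂ) (hf : DifferentiableAt ℝ f z) :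
    wirtingerBar (fun w => c * f w) z = c * wirtingerBar f z := by
  simp only [wirtingerBar, fderiv_const_mul hf, _root_.smul_apply, smul_eq_mul]
  ring

theorem fderiv_conj_comp (hf : DifferentiableAt ℝ f z) (v : ℂ) :
    fderiv ℝ (fun w => conj (f w)) z v = conj (fderiv ℝ f z v) := by
  have h := (Complex.conjCLE.toContinuousLinearMap.hasFDerivAt (x := f z)).comp z hf.hasFDerivAt
  have h' : HasFDerivAt (fun w => conj (f w))
    (Complex.conjCLE.toContinuousLinearMap.comp (fderiv ℝ f z)) z := h
  rw [h'.fderiv]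
  rfl

theorem wirtinger_conj (hf : DifferentiableAt ℝ f z) :
    wirtinger (fun w => conj (f w)) z = conj (wirtingerBar f z) := by
  simp only [wirtinger, wirtingerBar, fderiv_conj_comp hf]
  simp [Complex.conj_ofNat, sub_eq_add_neg]

theorem wirtingerBar_conj (hf : DifferentiableAt ℝ f z) :
    wirtingerBar (fun w => conj (f w)) z = conj (wirtinger f z) := by
  simp only [wirtinger, wirtingerBar, fderiv_conj_comp hf]
  simp [Complex.conj_ofNat]

theorem contDiff_fderiv_apply_const (hf : ContDiff ℝ ∞ f) (v : ℂ) :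
    ContDiff ℝ ∞ fun w => fderiv ℝ f w v :=
  (hf.fderiv_right (by simp)).clm_apply contDiff_const

theorem contDiff_wirtinger (hf : ContDiff ℝ ∞ f) : ContDiff ℝ ∞ (wirtinger f) :=
  contDiff_const.mul ((contDiff_fderiv_apply_const hf 1).sub
    (contDiff_const.mul (contDiff_fderiv_apply_const hf Complex.I)))

theorem contDiff_wirtingerBar (hf : ContDiff ℝ ∞ f) : ContDiff ℝ ∞ (wirtingerBar f) :=
  contDiff_const.mul ((contDiff_fderiv_apply_const hf 1).add
    (contDiff_const.mul (contDiff_fderiv_apply_const hf Complex.I)))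

theorem wirtinger_congr (h : f =ᶠ[𝓝 z] g) : wirtinger f z = wirtinger g z := by
  simp only [wirtinger, h.fderiv_eq]

theorem wirtingerBar_congr (h : f =ᶠ[𝓝 z] g) : wirtingerBar f z = wirtingerBar g z := by
  simp only [wirtingerBar, h.fderiv_eq]

theorem wirtingerBar_wirtinger_comm (hf : ContDiff ℝ ∞ f) (z : ℂ) :
    wirtingerBar (wirtinger f) z = wirtinger (wirtingerBar f) z := by
  have hd : ∀ v : ℂ, DifferentiableAt ℝ (fun w => fderiv ℝ f w v) z := fun v =>
    (contDiff_fderiv_apply_const hf v).differentiable (by simp) z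
  have hd' : DifferentiableAt ℝ (fderiv ℝ f) z :=
    (hf.fderiv_right (m := ∞) (by simp)).differentiable (by simp) z
  have hs : IsSymmSndFDerivAt ℝ f z := hf.contDiffAt.isSymmSndFDerivAt (by
    simp only [minSmoothness_of_isRCLikeNormedField]; exact WithTop.coe_le_coe.2 (le_top : (2 : ℕ∞) ≤ ⊤))
  have h2 : ∀ u v : ℂ, fderiv ℝ (fun w => fderiv ℝ f w v) z u = fderiv ℝ (fderiv ℝ f) z u v := by
    intro u v
    rw [fderiv_clm_apply hd' (differentiableAt_const v)]
    simp
  have e1 : ∀ u : ℂ, fderiv ℝ (wirtinger f) z u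
      = 1 / 2 * (fderiv ℝ (fderiv ℝ f) z u 1 - Complex.I * fderiv ℝ (fderiv ℝ f) z u Complex.I) := by
    intro u
    unfold wirtinger
    rw [fderiv_const_mul (DifferentiableAt.fun_sub (hd 1) ((hd _).const_mul _)), fderiv_fun_sub (hd 1) ((hd _).const_mul _),
      fderiv_const_mul (hd _)]
    simp [h2]
  have e2 : ∀ u : ℂ, fderiv ℝ (wirtingerBar f) z u
      = 1 / 2 * (fderiv ℝ (fderiv ℝ f) z u 1 + Complex.I * fderiv ℝ (fderiv ℝ f) z u Complex.I) := by
    intro u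
    unfold wirtingerBar
    rw [fderiv_const_mul (DifferentiableAt.fun_add (hd 1) ((hd _).const_mul _)), fderiv_fun_add (hd 1) ((hd _).const_mul _),
      fderiv_const_mul (hd _)]
    simp [h2, mul_add]
  -- Both sides are a quarter of the Laplacian once the mixed second derivatives are identified.
  have hsy : fderiv ℝ (fderiv ℝ f) z 1 Complex.I = fderiv ℝ (fderiv ℝ f) z Complex.I 1 := hs 1 Complex.I
  rw [wirtingerBar, wirtinger, e1, e1, e2, e2, hsy]
  ring

theorem hasCompactSupport_wirtinger (hf : HasCompactSupport f) :
    HasCompactSupport (wirtinger f) :=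
  (hf.fderiv ℝ).mono' fun z hz => by
    by_contra h
    apply hz
    have : fderiv ℝ f z = 0 := image_eq_zero_of_notMem_tsupport h
    simp [wirtinger, this]

theorem tsupport_wirtingerBar_subset : tsupport (wirtingerBar f) ⊆ tsupport f := by
  refine (closure_minimal ?_ (isClosed_tsupport _)).trans (tsupport_fderiv_subset ℝ)
  intro z hz
  by_contra h
  apply hz
  have : fderiv ℝ f z = 0 := image_eq_zero_of_notMem_tsupport h
  simp [wirtingerBar, this]

theorem hasCompactSupport_wirtingerBar (hf : HasCompactSupport f) :
    HasCompactSupport (wirtingerBar f) :=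
  HasCompactSupport.intro' hf (isClosed_tsupport _) fun _ hz =>
    image_eq_zero_of_notMem_tsupport fun h => hz (tsupport_wirtingerBar_subset h)

theorem integral_fderiv_apply_eq_zero (hf : ContDiff ℝ ∞ f) (hc : HasCompactSupport f) (v : ℂ) :
    ∫ z, fderiv ℝ f z v = 0 := by
  have h := integral_mul_fderiv_eq_neg_fderiv_mul_of_integrable (μ := volume) (v := v)
    (f := fun _ : ℂ => (1 : ℂ)) (g := f) (by simp)
    (by simpa using ((contDiff_fderiv_apply_const hf v).continuous.integrable_of_hasCompactSupport
      (hc.fderiv_apply ℝ v)))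
    (by simpa using hf.continuous.integrable_of_hasCompactSupport hc)
    (fun _ _ => differentiableAt_const _) (fun _ _ => hf.differentiable (by simp) _)
  simpa using h

theorem integrable_fderiv_apply (hf : ContDiff ℝ ∞ f) (hc : HasCompactSupport f) (v : ℂ) :
    Integrable fun z => fderiv ℝ f z v :=
  (contDiff_fderiv_apply_const hf v).continuous.integrable_of_hasCompactSupport
    (hc.fderiv_apply ℝ v)

theorem integral_wirtinger_eq_zero (hf : ContDiff ℝ ∞ f) (hc : HasCompactSupport f) :
    ∫ z, wirtinger f z = 0 := by
  unfold wirtinger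
  rw [integral_const_mul, integral_sub (integrable_fderiv_apply hf hc 1)
    ((integrable_fderiv_apply hf hc _).const_mul _), integral_const_mul,
    integral_fderiv_apply_eq_zero hf hc, integral_fderiv_apply_eq_zero hf hc]
  simp

theorem integral_wirtingerBar_eq_zero (hf : ContDiff ℝ ∞ f) (hc : HasCompactSupport f) :
    ∫ z, wirtingerBar f z = 0 := by
  unfold wirtingerBar
  rw [integral_const_mul, integral_add (integrable_fderiv_apply hf hc 1)
    ((integrable_fderiv_apply hf hc _).const_mul _), integral_const_mul,
    integral_fderiv_apply_eq_zero hf hc, integral_fderiv_apply_eq_zero hf hc]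
  simp

/-- The pointwise divergence identity behind the weighted Bochner formula. -/
theorem bochner_pointwise {a b E k p : ℂ → ℂ} (ha : ContDiff ℝ ∞ a) (hb : ContDiff ℝ ∞ b)
    (hE : ContDiff ℝ ∞ E) (hk : ContDiff ℝ ∞ k) (hp : ContDiff ℝ ∞ p) (z : ℂ)
    (hEz : wirtinger E z = E z * wirtinger p z)
    (hEb : wirtingerBar E z = E z * wirtingerBar p z) :
    wirtinger (fun w => k w * E w * a w * (wirtingerBar b w + wirtingerBar p w * b w)) z
      + wirtingerBar (fun w => -(E w * a w * (wirtinger k w * b w + k w * wirtinger b w))) z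
    = k z * E z * ((wirtinger a z + wirtinger p z * a z) * (wirtingerBar b z + wirtingerBar p z * b z)
        - wirtingerBar a z * wirtinger b z + wirtinger (wirtingerBar p) z * a z * b z)
      - E z * (wirtinger k z * wirtingerBar a z * b z + wirtingerBar k z * wirtinger b z * a z)
      - wirtinger (wirtingerBar k) z * a z * b z * E z := by
  have da : Differentiable ℝ a := ha.differentiable (by simp)
  have db : Differentiable ℝ b := hb.differentiable (by simp)
  have dE : Differentiable ℝ E := hE.differentiable (by simp)
  have dk : Differentiable ℝ k := hk.differentiable (by simp)
  have dbb : Differentiable ℝ (wirtingerBar b) := (contDiff_wirtingerBar hb).differentiable (by simp)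
  have dbp : Differentiable ℝ (wirtingerBar p) := (contDiff_wirtingerBar hp).differentiable (by simp)
  have dzb : Differentiable ℝ (wirtinger b) := (contDiff_wirtinger hb).differentiable (by simp)
  have dzk : Differentiable ℝ (wirtinger k) := (contDiff_wirtinger hk).differentiable (by simp)
  rw [wirtinger_mul (by fun_prop) (by fun_prop), wirtinger_mul (by fun_prop) (by fun_prop),
    wirtinger_mul (by fun_prop) (by fun_prop), wirtinger_add (by fun_prop) (by fun_prop),
    wirtinger_mul (f := wirtingerBar p) (by fun_prop) (by fun_prop),
    wirtingerBar_neg, wirtingerBar_mul (by fun_prop) (by fun_prop),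
    wirtingerBar_mul (by fun_prop) (by fun_prop), wirtingerBar_add (by fun_prop) (by fun_prop),
    wirtingerBar_mul (by fun_prop) (by fun_prop), wirtingerBar_mul (by fun_prop) (by fun_prop),
    hEz, hEb, wirtingerBar_wirtinger_comm hb, wirtingerBar_wirtinger_comm hk]
  ring

end WirtingerCalculus

/-! ### The twisted Bochner formula -/

section Bochner

theorem contDiff_ofReal_comp {f : ℂ → ℝ} (hf : ContDiff ℝ ∞ f) :
    ContDiff ℝ ∞ fun z => (f z : ℂ) :=
  Complex.ofRealCLM.contDiff.comp hf

theorem fderiv_ofReal_comp {f : ℂ → ℝ} {z : ℂ} (hf : DifferentiableAt ℝ f z) (v : ℂ) :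
    fderiv ℝ (fun w => (f w : ℂ)) z v = fderiv ℝ f z v := by
  have h' : HasFDerivAt (fun w => (f w : ℂ)) (Complex.ofRealCLM.comp (fderiv ℝ f z)) z :=
    (Complex.ofRealCLM.hasFDerivAt (x := f z)).comp z hf.hasFDerivAt
  rw [h'.fderiv]
  rfl

theorem fderiv_ofReal_exp {φ : ℂ → ℝ} {z : ℂ} (hφ : DifferentiableAt ℝ φ z) (v : ℂ) :
    fderiv ℝ (fun w => (Real.exp (φ w) : ℂ)) z v
      = Real.exp (φ z) * fderiv ℝ (fun w => (φ w : ℂ)) z v := by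
  rw [fderiv_ofReal_comp hφ.exp, fderiv_ofReal_comp hφ, fderiv_exp hφ]
  simp

theorem wirtinger_exp {φ : ℂ → ℝ} {z : ℂ} (hφ : DifferentiableAt ℝ φ z) :
    wirtinger (fun w => (Real.exp (φ w) : ℂ)) z
      = Real.exp (φ z) * wirtinger (fun w => (φ w : ℂ)) z := by
  simp only [wirtinger, fderiv_ofReal_exp hφ]
  ring

theorem wirtingerBar_exp {φ : ℂ → ℝ} {z : ℂ} (hφ : DifferentiableAt ℝ φ z) :
    wirtingerBar (fun w => (Real.exp (φ w) : ℂ)) z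
      = Real.exp (φ z) * wirtingerBar (fun w => (φ w : ℂ)) z := by
  simp only [wirtingerBar, fderiv_ofReal_exp hφ]
  ring

theorem conj_wirtinger_ofReal {f : ℂ → ℝ} {z : ℂ} (hf : DifferentiableAt ℝ f z) :
    conj (wirtinger (fun w => (f w : ℂ)) z) = wirtingerBar (fun w => (f w : ℂ)) z := by
  have h : DifferentiableAt ℝ (fun w => (f w : ℂ)) z := Complex.ofRealCLM.differentiableAt.comp z hf
  rw [← wirtingerBar_conj h]
  simp only [Complex.conj_ofReal]

/-- For real f, conjugation exchanges ∂ and ∂̄ and these commute, so ∂∂̄f is its own conjugate and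
taking the real part loses nothing. -/
theorem ofReal_leviCoeff {f : ℂ → ℝ} (hf : ContDiff ℝ ∞ f) (z : ℂ) :
    (leviCoeff f z : ℂ) = wirtinger (wirtingerBar fun w => (f w : ℂ)) z := by
  have hfc := contDiff_ofReal_comp hf
  have h : conj (wirtinger (wirtingerBar fun w => (f w : ℂ)) z)
      = wirtinger (wirtingerBar fun w => (f w : ℂ)) z := by
    rw [← wirtingerBar_conj ((contDiff_wirtingerBar hfc).differentiable (by simp) z),
      ← wirtingerBar_wirtinger_comm hfc]
    refine wirtingerBar_congr (Eventually.of_forall fun w => ?_)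
    show conj (wirtingerBar (fun w => (f w : ℂ)) w) = _
    rw [← conj_wirtinger_ofReal (hf.differentiable (by simp) w), Complex.conj_conj]
  exact Complex.conj_eq_iff_re.1 h

/-- Twisted Bochner formula for compactly supported functions: `φ` is the weight, `κ` the twist. -/
theorem bochner_integral {φ κ : ℂ → ℝ} {γ : ℂ → ℂ} (hφ : ContDiff ℝ ∞ φ) (hκ : ContDiff ℝ ∞ κ)
    (hγ : ContDiff ℝ ∞ γ) (hc : HasCompactSupport γ) :
    ∫ z, Real.exp (φ z) * (κ z * (‖wirtinger γ z + wirtinger (fun w => (φ w : ℂ)) z * γ z‖ ^ 2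
        - ‖wirtingerBar γ z‖ ^ 2 + leviCoeff φ z * ‖γ z‖ ^ 2)
      - 2 * (wirtinger (fun w => (κ w : ℂ)) z * wirtingerBar γ z * conj (γ z)).re
      - leviCoeff κ z * ‖γ z‖ ^ 2) = 0 := by
  set p : ℂ → ℂ := fun w => (φ w : ℂ) with hpdef
  set k : ℂ → ℂ := fun w => (κ w : ℂ) with hkdef
  set E : ℂ → ℂ := fun w => (Real.exp (φ w) : ℂ) with hEdef
  set b : ℂ → ℂ := fun w => conj (γ w) with hbdef
  have hp : ContDiff ℝ ∞ p := contDiff_ofReal_comp hφ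
  have hk : ContDiff ℝ ∞ k := contDiff_ofReal_comp hκ
  have hE : ContDiff ℝ ∞ E := contDiff_ofReal_comp hφ.exp
  have hb : ContDiff ℝ ∞ b := Complex.conjCLE.contDiff.comp hγ
  have hX : ContDiff ℝ ∞ (fun w => k w * E w * γ w * (wirtingerBar b w + wirtingerBar p w * b w)) :=
    ((hk.mul hE).mul hγ).mul ((contDiff_wirtingerBar hb).add ((contDiff_wirtingerBar hp).mul hb))
  have hY : ContDiff ℝ ∞ (fun w => -(E w * γ w * (wirtinger k w * b w + k w * wirtinger b w))) :=
    ((hE.mul hγ).mul (((contDiff_wirtinger hk).mul hb).add (hk.mul (contDiff_wirtinger hb)))).neg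
  have cX : HasCompactSupport
      (fun w => k w * E w * γ w * (wirtingerBar b w + wirtingerBar p w * b w)) :=
    hc.mono' fun w hw => subset_tsupport _ fun h => hw (by simp [h])
  have cY : HasCompactSupport
      (fun w => -(E w * γ w * (wirtinger k w * b w + k w * wirtinger b w))) :=
    hc.mono' fun w hw => subset_tsupport _ fun h => hw (by simp [h])
  -- The integrand is the divergence from `bochner_pointwise` with a = γ and b its conjugate; both
  -- differentiated functions have compact support, so the integral vanishes.
  have key : ∀ z, ((Real.exp (φ z) * (κ z * (‖wirtinger γ z + wirtinger p z * γ z‖ ^ 2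
        - ‖wirtingerBar γ z‖ ^ 2 + leviCoeff φ z * ‖γ z‖ ^ 2)
      - 2 * (wirtinger k z * wirtingerBar γ z * conj (γ z)).re
      - leviCoeff κ z * ‖γ z‖ ^ 2) : ℝ) : ℂ)
      = wirtinger (fun w => k w * E w * γ w * (wirtingerBar b w + wirtingerBar p w * b w)) z
      + wirtingerBar (fun w => -(E w * γ w * (wirtinger k w * b w + k w * wirtinger b w))) z := by
    intro z
    have dγ : DifferentiableAt ℝ γ z := hγ.differentiable (by simp) z
    have dφ : DifferentiableAt ℝ φ z := hφ.differentiable (by simp) z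
    have dκ : DifferentiableAt ℝ κ z := hκ.differentiable (by simp) z
    rw [bochner_pointwise hγ hb hE hk hp z (wirtinger_exp dφ) (wirtingerBar_exp dφ)]
    have e1 : wirtingerBar b z = conj (wirtinger γ z) := wirtingerBar_conj dγ
    have e2 : wirtinger b z = conj (wirtingerBar γ z) := wirtinger_conj dγ
    have e3 : wirtingerBar p z = conj (wirtinger p z) := (conj_wirtinger_ofReal dφ).symm
    have e4 : wirtingerBar k z = conj (wirtinger k z) := (conj_wirtinger_ofReal dκ).symm
    have e5 : ∀ u : ℂ, ((‖u‖ : ℂ)) ^ 2 = u * conj u := fun u => (Complex.mul_conj' u).symm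
    have e6 : ∀ u : ℂ, 2 * (u.re : ℂ) = u + conj u := fun u => (Complex.add_conj u).symm ▸ by simp
    push_cast
    rw [ofReal_leviCoeff hφ, ofReal_leviCoeff hκ, e6, e5, e5, e5, e1, e2, e3, e4]
    simp only [map_mul, map_add, Complex.conj_conj, hEdef, hkdef, hbdef, hpdef]
    push_cast
    ring
  have h0 : ∫ z, ((Real.exp (φ z) * (κ z * (‖wirtinger γ z + wirtinger p z * γ z‖ ^ 2
        - ‖wirtingerBar γ z‖ ^ 2 + leviCoeff φ z * ‖γ z‖ ^ 2)
      - 2 * (wirtinger k z * wirtingerBar γ z * conj (γ z)).re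
      - leviCoeff κ z * ‖γ z‖ ^ 2) : ℝ) : ℂ) = 0 := by
    simp_rw [key]
    rw [integral_add, integral_wirtinger_eq_zero hX cX, integral_wirtingerBar_eq_zero hY cY, add_zero]
    · exact (contDiff_wirtinger hX).continuous.integrable_of_hasCompactSupport
        (hasCompactSupport_wirtinger cX)
    · exact (contDiff_wirtingerBar hY).continuous.integrable_of_hasCompactSupport
        (hasCompactSupport_wirtingerBar cY)
  rw [integral_complex_ofReal] at h0
  exact_mod_cast h0

end Bochner

/-! ### Wirtinger derivatives of radial functions -/

section Radial

theorem hasFDerivAt_radial {f : ℝ → ℝ} {f' : ℝ} {z : ℂ} (h : HasDerivAt f f' (‖z‖ ^ 2)) :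
    HasFDerivAt (fun w : ℂ => f (‖w‖ ^ 2)) (f' • (2 • (innerSL ℝ z))) z :=
  h.comp_hasFDerivAt z (hasStrictFDerivAt_norm_sq z).hasFDerivAt

theorem wirtinger_radial {f : ℝ → ℝ} {f' : ℝ} {z : ℂ} (h : HasDerivAt f f' (‖z‖ ^ 2)) :
    wirtinger (fun w : ℂ => (f (‖w‖ ^ 2) : ℂ)) z = f' * conj z := by
  have h1 := hasFDerivAt_radial h
  simp only [wirtinger, fderiv_ofReal_comp h1.differentiableAt, h1.fderiv]
  simp [Complex.inner]
  rw [← Complex.re_add_im (conj z)]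
  simp
  ring

theorem wirtingerBar_radial {f : ℝ → ℝ} {f' : ℝ} {z : ℂ} (h : HasDerivAt f f' (‖z‖ ^ 2)) :
    wirtingerBar (fun w : ℂ => (f (‖w‖ ^ 2) : ℂ)) z = f' * z := by
  rw [← conj_wirtinger_ofReal (f := fun w : ℂ => f (‖w‖ ^ 2))
    (hasFDerivAt_radial h).differentiableAt, wirtinger_radial h]
  simp

theorem wirtinger_id (z : ℂ) : wirtinger (fun w => w) z = 1 := by
  simp [wirtinger]; norm_num

theorem wirtingerBar_id (z : ℂ) : wirtingerBar (fun w => w) z = 0 := by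
  simp [wirtingerBar]

theorem leviCoeff_radial {f f' : ℝ → ℝ} {f'' : ℝ} {z : ℂ}
    (h : ∀ t : ℝ, 0 ≤ t → HasDerivAt f (f' t) t) (h' : HasDerivAt f' f'' (‖z‖ ^ 2)) :
    leviCoeff (fun w : ℂ => f (‖w‖ ^ 2)) z = f'' * ‖z‖ ^ 2 + f' (‖z‖ ^ 2) := by
  have e : wirtingerBar (fun w : ℂ => (f (‖w‖ ^ 2) : ℂ)) = fun w => (f' (‖w‖ ^ 2) : ℂ) * w :=
    funext fun w => wirtingerBar_radial (h _ (by positivity))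
  have hd : DifferentiableAt ℝ (fun w : ℂ => (f' (‖w‖ ^ 2) : ℂ)) z :=
    Complex.ofRealCLM.differentiableAt.comp z (hasFDerivAt_radial h').differentiableAt
  rw [leviCoeff, e, wirtinger_mul hd differentiableAt_fun_id, wirtinger_radial h', wirtinger_id,
    mul_assoc, Complex.conj_mul']
  norm_cast
  simp

end Radial

/-! ### The dual estimate with a regularised logarithmic twist -/

section DualInequality

/-- Zeros of p away from the support of β do no harm: the quotient vanishes identically near such
points. -/
theorem contDiff_div_of_tsupport {β : ℂ → ℂ} {p : ℂ → ℝ} (hβ : ContDiff ℝ ∞ β)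
    (hp : ContDiff ℝ ∞ p) (h : ∀ z ∈ tsupport β, p z ≠ 0) :
    ContDiff ℝ ∞ fun z => β z / (p z : ℂ) := by
  rw [contDiff_iff_contDiffAt]
  intro z
  by_cases hz : z ∈ tsupport β
  · have := (contDiff_ofReal_comp hp).contDiffAt (x := z)
    simp only [div_eq_mul_inv]
    exact hβ.contDiffAt.mul (this.inv (by exact_mod_cast h z hz))
  · have : (fun z => β z / (p z : ℂ)) =ᶠ[𝓝 z] fun _ => 0 := by
      filter_upwards [notMem_tsupport_iff_eventuallyEq.1 hz] with w hw
      simp [hw]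
    exact contDiffAt_const.congr_of_eventuallyEq this

theorem hasDerivAt_logTwist {R δ t : ℝ} (hδ : 0 < δ) (hR : 0 < R) (ht : 0 ≤ t) :
    HasDerivAt (fun t => (t + δ) / R - 1 - Real.log ((t + δ) / R)) (1 / R - 1 / (t + δ)) t := by
  have h0 : HasDerivAt (fun t : ℝ => (t + δ) / R) (1 / R) t :=
    ((hasDerivAt_id t).add_const δ).div_const R
  have h1 := (h0.sub_const 1).sub (h0.log (by positivity))
  have : t + δ ≠ 0 := by positivity
  have e : 1 / R - 1 / (t + δ) = 1 / R - 1 / R / ((t + δ) / R) := by field_simp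
  rw [e]
  exact h1

theorem hasDerivAt_deriv_logTwist {R δ t : ℝ} (hδ : 0 < δ) (ht : 0 ≤ t) :
    HasDerivAt (fun t => 1 / R - 1 / (t + δ)) (1 / (t + δ) ^ 2) t := by
  have h0 : HasDerivAt (fun t : ℝ => t + δ) 1 t := (hasDerivAt_id t).add_const δ
  have h1 := (h0.inv (by positivity : t + δ ≠ 0)).const_sub (1 / R)
  have e : 1 / (t + δ) ^ 2 = -(-1 / (t + δ) ^ 2) := by ring
  rw [e]
  simpa [one_div] using! h1

/-- Pointwise comparison in the twisted Bochner formula, where `g`, `gz`, `gzb` stand for a function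
and its Wirtinger derivatives, `D` for its weighted derivative and `l` for the curvature. -/
theorem twisted_pointwise_le {z g gzb D : ℂ} {S R δ l κ p : ℝ} (hδ : 0 < δ) (hS : 0 < S)
    (hR : 0 < R) (hz : ‖z‖ ^ 2 = S - δ) (hp : p = 1 - S / R) (pz : 0 < p) (hl : 0 ≤ l)
    (hκ : κ = S / R - 1 - Real.log (S / R)) :
    δ / S ^ 2 * (p ^ 2 * ‖g‖ ^ 2) ≤
      R / S * ‖((-(1 / R) : ℝ) : ℂ) * z * g + p * gzb‖ ^ 2
        + (κ * (‖D‖ ^ 2 - ‖gzb‖ ^ 2 + l * ‖g‖ ^ 2)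
          - 2 * (((1 / R - 1 / S : ℝ) : ℂ) * conj z * gzb * conj g).re
          - (1 / S ^ 2 * ‖z‖ ^ 2 + (1 / R - 1 / S)) * ‖g‖ ^ 2) := by
  have ex : ‖((-(1 / R) : ℝ) : ℂ) * z * g + p * gzb‖ ^ 2
      = (1 / R) ^ 2 * ‖z‖ ^ 2 * ‖g‖ ^ 2 + p ^ 2 * ‖gzb‖ ^ 2
        - 2 * (p / R) * (conj z * gzb * conj g).re := by
    simp only [Complex.sq_norm, Complex.normSq_apply, Complex.add_re, Complex.add_im,
      Complex.mul_re, Complex.mul_im, Complex.ofReal_re, Complex.ofReal_im, Complex.conj_re,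
      Complex.conj_im]
    ring
  have ex2 : (((1 / R - 1 / S : ℝ) : ℂ) * conj z * gzb * conj g).re
      = (1 / R - 1 / S) * (conj z * gzb * conj g).re := by
    rw [mul_assoc, mul_assoc, Complex.re_ofReal_mul, mul_assoc]
  rw [ex, ex2]
  -- With x = S/R, the two bounds 1 - 1/x ≤ log x ≤ x - 1 say precisely that κ ≤ (R/S)p² and κ ≥ 0.
  have hlog := Real.log_le_sub_one_of_pos (div_pos hS hR)
  have hlog' := Real.one_sub_inv_le_log_of_pos (div_pos hS hR)
  have hκ0 : 0 ≤ κ := by rw [hκ]; linarith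
  have hcoef : 0 ≤ R / S * p ^ 2 - κ := by
    have : R / S * p ^ 2 - κ = (S / R)⁻¹ - 1 + Real.log (S / R) := by
      rw [hp, hκ]; field_simp; ring
    rw [this]; linarith
  have hp1 : p ≤ 1 := by rw [hp]; linarith [div_pos hS hR]
  -- The cross terms cancel because p/S = 1/S - 1/R, and the coefficients of |g|² collapse to δp/S².
  -- What remains is a sum of nonnegative terms.
  have id1 : R / S * ((1 / R) ^ 2 * ‖z‖ ^ 2 * ‖g‖ ^ 2 + p ^ 2 * ‖gzb‖ ^ 2
        - 2 * (p / R) * (conj z * gzb * conj g).re)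
      + (κ * (‖D‖ ^ 2 - ‖gzb‖ ^ 2 + l * ‖g‖ ^ 2)
      - 2 * ((1 / R - 1 / S) * (conj z * gzb * conj g).re)
      - (1 / S ^ 2 * ‖z‖ ^ 2 + (1 / R - 1 / S)) * ‖g‖ ^ 2)
      = κ * ‖D‖ ^ 2 + κ * l * ‖g‖ ^ 2 + (R / S * p ^ 2 - κ) * ‖gzb‖ ^ 2
        + δ / S ^ 2 * p * ‖g‖ ^ 2 := by
    rw [hz]
    have : S = R * (1 - p) := by rw [hp]; field_simp; ring
    have h1 : (1:ℝ) / S ≠ 0 := by positivity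
    have e : R / S * p = R / S - 1 := by rw [hp]; field_simp
    field_simp
    rw [this]
    ring
  rw [id1]
  have t1 : 0 ≤ κ * ‖D‖ ^ 2 := by positivity
  have t2 : 0 ≤ κ * l * ‖g‖ ^ 2 := by positivity
  have t3 : 0 ≤ (R / S * p ^ 2 - κ) * ‖gzb‖ ^ 2 := by positivity
  have t4 : δ / S ^ 2 * (p ^ 2 * ‖g‖ ^ 2) ≤ δ / S ^ 2 * p * ‖g‖ ^ 2 := by
    rw [mul_assoc (δ / S ^ 2)]
    gcongr
    nlinarith
  linarith

set_option maxHeartbeats 400000 in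
/-- Regularised dual form of the sharp extension inequality on a disc. -/
theorem dual_inequality_regularized {φ : ℂ → ℝ} {β : ℂ → ℂ} {ρ δ : ℝ} (hδ : 0 < δ)
    (hφ : ContDiff ℝ ∞ φ) (hsub : ∀ z ∈ Metric.ball (0 : ℂ) ρ, 0 ≤ leviCoeff φ z)
    (hβ : ContDiff ℝ ∞ β) (hc : HasCompactSupport β) (hs : tsupport β ⊆ Metric.ball 0 ρ) :
    ∫ z, Real.exp (φ z) * (δ / (‖z‖ ^ 2 + δ) ^ 2 * ‖β z‖ ^ 2)
      ≤ ∫ z, Real.exp (φ z) * ((ρ ^ 2 + δ) / (‖z‖ ^ 2 + δ) * ‖wirtingerBar β z‖ ^ 2) := by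
  set R := ρ ^ 2 + δ with hR
  have hRpos : 0 < R := by positivity
  have hS : ∀ z : ℂ, 0 < ‖z‖ ^ 2 + δ := fun z => by positivity
  -- With S = |z|² + δ, the twist vanishes on |z| = ρ and its Levi coefficient is 1/R - δ/S²: up to
  -- a constant, minus an approximate Dirac mass. As a function of |z|² its derivative is -p/S,
  -- which is why Bochner is applied to γ = β/p.
  set κ : ℂ → ℝ := fun z => (‖z‖ ^ 2 + δ) / R - 1 - Real.log ((‖z‖ ^ 2 + δ) / R) with hκdef
  set p : ℂ → ℝ := fun z => 1 - (‖z‖ ^ 2 + δ) / R with hpdef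
  have hn : ContDiff ℝ ∞ fun z : ℂ => (‖z‖ ^ 2 + δ) / R :=
    ((contDiff_norm_sq ℝ).add contDiff_const).div_const _
  have hκ : ContDiff ℝ ∞ κ :=
    (hn.sub contDiff_const).sub (hn.log fun z => (div_pos (hS z) hRpos).ne')
  have hp : ContDiff ℝ ∞ p := contDiff_const.sub hn
  have hppos : ∀ z ∈ Metric.ball (0 : ℂ) ρ, 0 < p z := by
    intro z hz
    rw [mem_ball_zero_iff] at hz
    have : (‖z‖ ^ 2 + δ) / R < 1 := by
      rw [div_lt_one hRpos, hR]
      have := norm_nonneg z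
      nlinarith
    simp only [hpdef]; linarith
  set γ : ℂ → ℂ := fun z => β z / (p z : ℂ) with hγdef
  have hγ : ContDiff ℝ ∞ γ := contDiff_div_of_tsupport hβ hp fun z hz => (hppos z (hs hz)).ne'
  have hγc : HasCompactSupport γ := hc.mono' fun z hz => subset_tsupport _ fun h => hz (by
    simp [hγdef, h])
  have hβγ : β = fun z => (p z : ℂ) * γ z := by
    funext z
    by_cases hz : z ∈ tsupport β
    · have : (p z : ℂ) ≠ 0 := by exact_mod_cast (hppos z (hs hz)).ne'
      simp only [hγdef]; field_simp
    · simp [hγdef, image_eq_zero_of_notMem_tsupport hz]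
  have d1 := fun t ht => hasDerivAt_logTwist (t := t) hδ hRpos ht
  have d2 := fun t ht => hasDerivAt_deriv_logTwist (t := t) (R := R) hδ ht
  have hκz : ∀ z, wirtinger (fun w => (κ w : ℂ)) z
      = ((1 / R - 1 / (‖z‖ ^ 2 + δ) : ℝ) : ℂ) * conj z := fun z =>
    wirtinger_radial (f := fun t => (t + δ) / R - 1 - Real.log ((t + δ) / R))
      (d1 (‖z‖ ^ 2) (sq_nonneg _))
  have hκl : ∀ z, leviCoeff κ z = 1 / (‖z‖ ^ 2 + δ) ^ 2 * ‖z‖ ^ 2 + (1 / R - 1 / (‖z‖ ^ 2 + δ)) :=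
    fun z => leviCoeff_radial (f := fun t => (t + δ) / R - 1 - Real.log ((t + δ) / R))
      (f' := fun t => 1 / R - 1 / (t + δ)) d1 (d2 (‖z‖ ^ 2) (sq_nonneg _))
  have hpz : ∀ z, wirtingerBar (fun w => (p w : ℂ)) z = ((-(1 / R) : ℝ) : ℂ) * z := by
    intro z
    refine wirtingerBar_radial (f := fun t => 1 - (t + δ) / R) ?_
    exact (((hasDerivAt_id _).add_const δ).div_const R).const_sub 1
  have hβz : ∀ z, wirtingerBar β z = ((-(1 / R) : ℝ) : ℂ) * z * γ z + p z * wirtingerBar γ z := by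
    intro z
    conv_lhs => rw [hβγ]
    rw [wirtingerBar_mul ((contDiff_ofReal_comp hp).differentiable (by simp) z)
      (hγ.differentiable (by simp) z), hpz]
  have cφ := hφ.continuous
  have cS : ∀ c : ℝ, Continuous fun z : ℂ => c / (‖z‖ ^ 2 + δ) := fun c =>
    continuous_const.div (by fun_prop) fun z => (hS z).ne'
  have cS2 : ∀ c : ℝ, Continuous fun z : ℂ => c / (‖z‖ ^ 2 + δ) ^ 2 := fun c =>
    continuous_const.div (by fun_prop) fun z => (pow_pos (hS z) 2).ne'
  have cβ := hβ.continuous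
  have cγ := hγ.continuous
  have cβz := (contDiff_wirtingerBar hβ).continuous
  have cγz := (contDiff_wirtingerBar hγ).continuous
  have cγw := (contDiff_wirtinger hγ).continuous
  have cκ := hκ.continuous
  have cκz := (contDiff_wirtinger (contDiff_ofReal_comp hκ)).continuous
  have cφz := (contDiff_wirtinger (contDiff_ofReal_comp hφ)).continuous
  have clevi : ∀ f : ℂ → ℝ, ContDiff ℝ ∞ f → Continuous (leviCoeff f) := fun f hf =>
    Complex.continuous_re.comp
      (contDiff_wirtinger (contDiff_wirtingerBar (contDiff_ofReal_comp hf))).continuous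
  have clφ := clevi φ hφ
  have clκ := clevi κ hκ
  have i1 : Integrable fun z => Real.exp (φ z) * (δ / (‖z‖ ^ 2 + δ) ^ 2 * ‖β z‖ ^ 2) := by
    refine Continuous.integrable_of_hasCompactSupport ?_ ?_
    · have := cS2 δ
      fun_prop
    · exact hc.mono' fun z hz => subset_tsupport _ fun h => hz (by simp [h])
  have i2 : Integrable fun z =>
      Real.exp (φ z) * (R / (‖z‖ ^ 2 + δ) * ‖wirtingerBar β z‖ ^ 2) := by
    refine Continuous.integrable_of_hasCompactSupport ?_ ?_
    · have := cS R
      fun_prop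
    · exact (hasCompactSupport_wirtingerBar hc).mono' fun z hz => subset_tsupport _ fun h =>
        hz (by simp [h])
  have zoff : ∀ z, z ∉ tsupport γ → γ z = 0 ∧ wirtingerBar γ z = 0 ∧ wirtinger γ z = 0 := by
    intro z hz
    have : fderiv ℝ γ z = 0 :=
      image_eq_zero_of_notMem_tsupport fun h => hz (tsupport_fderiv_subset ℝ h)
    exact ⟨image_eq_zero_of_notMem_tsupport hz, by simp [wirtingerBar, this],
      by simp [wirtinger, this]⟩
  have i3 : Integrable fun z => Real.exp (φ z) * (κ z *
        (‖wirtinger γ z + wirtinger (fun w => (φ w : ℂ)) z * γ z‖ ^ 2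
        - ‖wirtingerBar γ z‖ ^ 2 + leviCoeff φ z * ‖γ z‖ ^ 2)
      - 2 * (wirtinger (fun w => (κ w : ℂ)) z * wirtingerBar γ z * conj (γ z)).re
      - leviCoeff κ z * ‖γ z‖ ^ 2) := by
    refine Continuous.integrable_of_hasCompactSupport ?_ ?_
    · exact cφ.rexp.mul (((cκ.mul ((((cγw.add (cφz.mul cγ)).norm.pow 2).sub
        (cγz.norm.pow 2)).add (clφ.mul (cγ.norm.pow 2)))).sub
        (continuous_const.mul (Complex.continuous_re.comp
          ((cκz.mul cγz).mul (Complex.continuous_conj.comp cγ))))).sub (clκ.mul (cγ.norm.pow 2)))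
    · refine HasCompactSupport.intro' hγc (isClosed_tsupport _) fun z hz => ?_
      obtain ⟨h1, h2, h3⟩ := zoff z hz
      simp [h1, h2, h3]
  have hts : tsupport γ ⊆ tsupport β := closure_mono fun z hz h => hz (by simp [hγdef, h])
  -- Adding the Bochner integral, which is zero, makes the inequality hold pointwise.
  rw [← add_zero (∫ z, Real.exp (φ z) * (R / (‖z‖ ^ 2 + δ) * ‖wirtingerBar β z‖ ^ 2)),
    ← bochner_integral hφ hκ hγ hγc, ← integral_add i2 i3]
  refine integral_mono i1 (i2.add i3) fun z => ?_
  simp only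
  rw [← mul_add]
  refine mul_le_mul_of_nonneg_left ?_ (Real.exp_pos _).le
  by_cases hz : z ∈ tsupport γ
  swap
  · obtain ⟨h1, h2, h3⟩ := zoff z hz
    rw [hβz z]
    simp [hβγ, h1, h2, h3]
  have hzb := hs (hts hz)
  have pz := hppos z hzb
  have lφ := hsub z hzb
  have hSz := hS z
  rw [hκz, hκl, hβz]
  have nβ : ‖β z‖ ^ 2 = p z ^ 2 * ‖γ z‖ ^ 2 := by
    conv_lhs => rw [hβγ]
    simp only [norm_mul, Complex.norm_real, mul_pow, Real.norm_eq_abs, sq_abs]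
  rw [nβ]
  exact twisted_pointwise_le hδ (hS z) hRpos (by simp) rfl pz lφ rfl

end DualInequality

/-! ### Radial integrals and the approximate Dirac mass -/

section RadialIntegrals

/-- Integrals of nonnegative radial functions over `ℂ` via a primitive in `‖z‖ ^ 2`. -/
theorem integrable_radial_and_integral {f F : ℝ → ℝ} {m : ℝ} (hf : ∀ t, 0 ≤ t → 0 ≤ f t)
    (hF : ∀ t, 0 ≤ t → HasDerivAt F (f t) t) (hm : Tendsto F atTop (𝓝 m)) :
    Integrable (fun z : ℂ => f (‖z‖ ^ 2)) ∧ ∫ z : ℂ, f (‖z‖ ^ 2) = Real.pi * (m - F 0) := by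
  have hd : ∀ y ∈ Ici (0 : ℝ), HasDerivAt (fun y => F (y ^ 2) / 2) (y * f (y ^ 2)) y := by
    intro y _
    have h1 := (HasDerivAt.comp (h₂ := F) (h := fun y : ℝ => y ^ 2) y
      (hF (y ^ 2) (sq_nonneg y)) (hasDerivAt_pow 2 y)).div_const 2
    have e : y * f (y ^ 2) = f (y ^ 2) * (((2 : ℕ) : ℝ) * y ^ (2 - 1)) / 2 := by
      push_cast; ring
    rw [e]
    exact h1
  have hpos : ∀ y ∈ Ioi (0 : ℝ), 0 ≤ y * f (y ^ 2) := fun y hy =>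
    mul_nonneg (le_of_lt hy) (hf _ (sq_nonneg _))
  have ht : Tendsto (fun y : ℝ => F (y ^ 2) / 2) atTop (𝓝 (m / 2)) :=
    (hm.comp (tendsto_pow_atTop two_ne_zero)).div_const 2
  have hI := integrableOn_Ioi_deriv_of_nonneg' hd hpos ht
  have hV := integral_Ioi_of_hasDerivAt_of_nonneg' hd hpos ht
  constructor
  · rw [integrable_fun_norm_addHaar volume (f := fun y => f (y ^ 2))]
    simpa using hI
  · rw [integral_fun_norm_addHaar volume (fun y => f (y ^ 2))]
    have : volume.real (Metric.ball (0 : ℂ) 1) = Real.pi := by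
      simp [Measure.real, Complex.volume_ball]
    simp only [Complex.finrank_real_complex, Nat.add_one_sub_one, pow_one, smul_eq_mul, hV, this]
    simp
    ring

theorem integral_sq_inv_one_add_sq :
    Integrable (fun z : ℂ => 1 / (‖z‖ ^ 2 + 1) ^ 2) ∧
      ∫ z : ℂ, 1 / (‖z‖ ^ 2 + 1) ^ 2 = Real.pi := by
  -- Taking R = 0 below, where 1/0 = 0 by convention, reuses the derivative of the twist for the
  -- primitive -1/(t+1).
  have h := integrable_radial_and_integral (f := fun t => 1 / (t + 1) ^ 2)
    (F := fun t => 0 - 1 / (t + 1)) (m := 0) (fun t _ => by positivity)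
    (fun t ht => hasDerivAt_deriv_logTwist (R := 0) one_pos ht |>.congr_of_eventuallyEq
      (Eventually.of_forall fun t => by simp)) (by
      have : Tendsto (fun t : ℝ => 1 / (t + 1)) atTop (𝓝 0) := by
        simp only [one_div]
        exact tendsto_inv_atTop_zero.comp (tendsto_atTop_add_const_right _ _ tendsto_id)
      simpa using this.const_sub 0)
  simpa using h

/-- The substitution z = √δ w turns the kernel into the fixed density 1/(|w|²+1)² of mass π;
dominated convergence does the rest. -/
theorem tendsto_integral_approx_dirac {g : ℂ → ℝ} (hg : Continuous g) (hc : HasCompactSupport g) :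
    Tendsto (fun δ : ℝ => ∫ z, δ / (‖z‖ ^ 2 + δ) ^ 2 * g z) (𝓝[>] 0) (𝓝 (Real.pi * g 0)) := by
  obtain ⟨C, hC⟩ := hc.exists_bound_of_continuous hg
  have h1 : Tendsto (fun δ : ℝ => ∫ w : ℂ, 1 / (‖w‖ ^ 2 + 1) ^ 2 * g (√δ • w)) (𝓝[>] 0)
      (𝓝 (∫ w : ℂ, 1 / (‖w‖ ^ 2 + 1) ^ 2 * g 0)) := by
    refine tendsto_integral_filter_of_dominated_convergence
      (fun w => 1 / (‖w‖ ^ 2 + 1) ^ 2 * C) ?_ ?_ (integral_sq_inv_one_add_sq.1.mul_const C) ?_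
    · refine Eventually.of_forall fun δ => ?_
      exact integral_sq_inv_one_add_sq.1.aestronglyMeasurable.mul
        (hg.comp (continuous_const_smul _)).aestronglyMeasurable
    · refine Eventually.of_forall fun δ => Eventually.of_forall fun w => ?_
      rw [norm_mul, Real.norm_of_nonneg (by positivity)]
      exact mul_le_mul_of_nonneg_left (hC _) (by positivity)
    · refine Eventually.of_forall fun w => Tendsto.const_mul _ ?_
      have : Tendsto (fun δ : ℝ => √δ • w) (𝓝[>] 0) (𝓝 0) := by
        have hc : Continuous fun δ : ℝ => √δ • w := by fun_prop
        have h := (hc.tendsto 0).mono_left (nhdsWithin_le_nhds (s := Ioi 0))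
        simpa using h
      exact (hg.tendsto 0).comp this
  rw [integral_mul_const, integral_sq_inv_one_add_sq.2] at h1
  refine h1.congr' ?_
  filter_upwards [self_mem_nhdsWithin] with δ hδ
  have hδ' : (0 : ℝ) < δ := hδ
  have h2 := Measure.integral_comp_smul (volume : Measure ℂ)
    (fun z : ℂ => δ / (‖z‖ ^ 2 + δ) ^ 2 * g z) (√δ)
  rw [Complex.finrank_real_complex, Real.sq_sqrt hδ'.le, abs_of_pos (inv_pos.2 hδ')] at h2
  have h3 : ∫ z, δ / (‖z‖ ^ 2 + δ) ^ 2 * g z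
      = δ * ∫ x : ℂ, δ / (‖√δ • x‖ ^ 2 + δ) ^ 2 * g (√δ • x) := by
    rw [h2, smul_eq_mul, mul_inv_cancel_left₀ hδ'.ne']
  rw [h3, ← integral_const_mul]
  refine integral_congr_ae (Eventually.of_forall fun w => ?_)
  simp only [norm_smul, mul_pow, Real.norm_eq_abs, sq_abs, Real.sq_sqrt hδ'.le]
  have : ‖w‖ ^ 2 + 1 ≠ 0 := by positivity
  have h4 : δ * ‖w‖ ^ 2 + δ = δ * (‖w‖ ^ 2 + 1) := by ring
  rw [h4]
  field_simp

end RadialIntegrals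

/-! ### A radial mollifier with an explicit ∂̄-primitive -/

section Mollifier

/-- A smooth cutoff: `1` for `t ≤ ε ^ 2 / 2` and `0` for `ε ^ 2 ≤ t`. -/
def cutoff (ε t : ℝ) : ℝ := Real.smoothTransition (2 - 2 * t / ε ^ 2)

theorem contDiff_cutoff (ε : ℝ) : ContDiff ℝ ∞ (cutoff ε) :=
  Real.smoothTransition.contDiff.comp
    (contDiff_const.sub ((contDiff_const.mul contDiff_id).div_const _))

theorem cutoff_zero (ε : ℝ) : cutoff ε 0 = 1 :=
  Real.smoothTransition.one_of_one_le (by norm_num)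

theorem cutoff_of_le {ε t : ℝ} (hε : 0 < ε) (h : ε ^ 2 ≤ t) : cutoff ε t = 0 := by
  refine Real.smoothTransition.zero_of_nonpos ?_
  have : 1 ≤ t / ε ^ 2 := (one_le_div (by positivity)).2 h
  rw [mul_div_assoc]
  linarith

theorem antitone_cutoff (ε : ℝ) : Antitone (cutoff ε) := fun s t hst =>
  Real.smoothTransition.monotone (by gcongr)

/-- A smooth radial probability density supported in the disc of radius `ε`. -/
def mollifier (ε : ℝ) (z : ℂ) : ℝ := -deriv (cutoff ε) (‖z‖ ^ 2) / Real.pi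

theorem contDiff_mollifier (ε : ℝ) : ContDiff ℝ ∞ (mollifier ε) :=
  (((contDiff_infty_iff_deriv.1 (contDiff_cutoff ε)).2.comp (contDiff_norm_sq ℝ)).neg).div_const _

theorem mollifier_nonneg (ε : ℝ) (z : ℂ) : 0 ≤ mollifier ε z :=
  div_nonneg (neg_nonneg.2 (antitone_cutoff ε).deriv_nonpos) Real.pi_pos.le

theorem mollifier_neg (ε : ℝ) (z : ℂ) : mollifier ε (-z) = mollifier ε z := by
  simp [mollifier]

theorem mollifier_eq_zero {ε : ℝ} (hε : 0 < ε) {z : ℂ} (hz : ε < ‖z‖) : mollifier ε z = 0 := by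
  have h : cutoff ε =ᶠ[𝓝 (‖z‖ ^ 2)] fun _ => 0 := by
    have : ε ^ 2 < ‖z‖ ^ 2 := by gcongr
    filter_upwards [lt_mem_nhds this] with t ht
    exact cutoff_of_le hε ht.le
  simp [mollifier, h.deriv_eq]

theorem tsupport_mollifier_subset {ε : ℝ} (hε : 0 < ε) :
    tsupport (mollifier ε) ⊆ Metric.closedBall 0 ε :=
  closure_minimal (fun z hz => by
    rw [mem_closedBall_zero_iff]
    by_contra h
    exact hz (mollifier_eq_zero hε (not_le.1 h))) Metric.isClosed_closedBall

theorem hasCompactSupport_mollifier {ε : ℝ} (hε : 0 < ε) : HasCompactSupport (mollifier ε) :=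
  (isCompact_closedBall 0 ε).of_isClosed_subset (isClosed_tsupport _)
    (tsupport_mollifier_subset hε)

/-- In the variable |z|² the density has primitive -cutoff/π, and the cutoff falls from 1 to 0. -/
theorem integral_mollifier {ε : ℝ} (hε : 0 < ε) : ∫ z, mollifier ε z = 1 := by
  have h := (integrable_radial_and_integral (f := fun t => -deriv (cutoff ε) t / Real.pi)
    (F := fun t => -cutoff ε t / Real.pi) (m := 0)
    (fun t _ => div_nonneg (neg_nonneg.2 (antitone_cutoff ε).deriv_nonpos) Real.pi_pos.le)
    (fun t _ => (((contDiff_cutoff ε).differentiable (by simp) t).hasDerivAt.neg).div_const _)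
    (tendsto_const_nhds.congr' (by
      filter_upwards [eventually_ge_atTop (ε ^ 2)] with t ht
      simp [cutoff_of_le hε ht]))).2
  have e : ∫ z, mollifier ε z = ∫ z : ℂ, -deriv (cutoff ε) (‖z‖ ^ 2) / Real.pi := rfl
  rw [e, h, cutoff_zero]
  field_simp
  ring

end Mollifier

/-! ### The limit δ → 0 and the distance to the range of ∂̄ -/

section DualInequality

/-- Dual form of the sharp extension inequality on the disc of radius `ρ`. -/
theorem dual_inequality {φ : ℂ → ℝ} {β u : ℂ → ℂ} {ρ : ℝ}
    (hφ : ContDiff ℝ ∞ φ) (hsub : ∀ z ∈ Metric.ball (0 : ℂ) ρ, 0 ≤ leviCoeff φ z)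
    (hβ : ContDiff ℝ ∞ β) (hc : HasCompactSupport β) (hs : tsupport β ⊆ Metric.ball 0 ρ)
    (hu : Continuous u) (huc : HasCompactSupport u) (hβu : ∀ z, wirtingerBar β z = z * u z) :
    Real.pi * (Real.exp (φ 0) * ‖β 0‖ ^ 2) ≤ ρ ^ 2 * ∫ z, Real.exp (φ z) * ‖u z‖ ^ 2 := by
  have cφ := hφ.continuous
  have cβ := hβ.continuous
  have hlim := tendsto_integral_approx_dirac (g := fun z => Real.exp (φ z) * ‖β z‖ ^ 2)
    (by fun_prop) (hc.mono' fun z hz => subset_tsupport _ fun h => hz (by simp [h]))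
  have iu : Integrable fun z => Real.exp (φ z) * ‖u z‖ ^ 2 :=
    Continuous.integrable_of_hasCompactSupport (by fun_prop)
      (huc.mono' fun z hz => subset_tsupport _ fun h => hz (by simp [h]))
  have hlim2 : Tendsto (fun δ : ℝ => (ρ ^ 2 + δ) * ∫ z, Real.exp (φ z) * ‖u z‖ ^ 2) (𝓝[>] 0)
      (𝓝 (ρ ^ 2 * ∫ z, Real.exp (φ z) * ‖u z‖ ^ 2)) := by
    have : Tendsto (fun δ : ℝ => (ρ ^ 2 + δ) * ∫ z, Real.exp (φ z) * ‖u z‖ ^ 2) (𝓝 0)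
        (𝓝 ((ρ ^ 2 + 0) * ∫ z, Real.exp (φ z) * ‖u z‖ ^ 2)) :=
      (tendsto_id.const_add (ρ ^ 2)).mul_const _
    rw [add_zero] at this
    exact this.mono_left nhdsWithin_le_nhds
  refine le_of_tendsto_of_tendsto hlim hlim2 ?_
  filter_upwards [self_mem_nhdsWithin] with δ hδ
  have hδ' : (0 : ℝ) < δ := hδ
  have h := dual_inequality_regularized hδ' hφ hsub hβ hc hs
  calc _ = ∫ z, Real.exp (φ z) * (δ / (‖z‖ ^ 2 + δ) ^ 2 * ‖β z‖ ^ 2) := by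
        congr 1; ext z; ring
    _ ≤ _ := h
    _ ≤ ∫ z, (ρ ^ 2 + δ) * (Real.exp (φ z) * ‖u z‖ ^ 2) := by
        refine integral_mono_of_nonneg (Eventually.of_forall fun z => by positivity)
          (iu.const_mul _) (Eventually.of_forall fun z => ?_)
        simp only [hβu, norm_mul, mul_pow]
        -- Divisibility of ∂̄β by z compensates the weight 1/(|z|²+δ), which would otherwise become
        -- singular at 0.
        have : ‖z‖ ^ 2 / (‖z‖ ^ 2 + δ) ≤ 1 := (div_le_one (by positivity)).2 (by linarith)
        calc _ = (‖z‖ ^ 2 / (‖z‖ ^ 2 + δ)) * ((ρ ^ 2 + δ) * (Real.exp (φ z) * ‖u z‖ ^ 2)) := by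
              ring
          _ ≤ 1 * ((ρ ^ 2 + δ) * (Real.exp (φ z) * ‖u z‖ ^ 2)) := by gcongr
          _ = _ := one_mul _
    _ = _ := integral_const_mul _ _

/-- Apply the dual inequality to β = θ + zv with θ = cutoff(|z|²)/π. Then β(0) = 1/π whatever v is,
while ∂̄β = z(∂̄v - mollifier), so v is free to range over all test functions. -/
theorem mollifier_dual_inequality {φ : ℂ → ℝ} {v : ℂ → ℂ} {ρ ε : ℝ} (hε : 0 < ε) (hερ : ε < ρ)
    (hφ : ContDiff ℝ ∞ φ) (hsub : ∀ z ∈ Metric.ball (0 : ℂ) ρ, 0 ≤ leviCoeff φ z)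
    (hv : ContDiff ℝ ∞ v) (hc : HasCompactSupport v) (hs : tsupport v ⊆ Metric.ball 0 ρ) :
    Real.exp (φ 0) / (Real.pi * ρ ^ 2)
      ≤ ∫ z, Real.exp (φ z) * ‖(mollifier ε z : ℂ) - wirtingerBar v z‖ ^ 2 := by
  have hρ : 0 < ρ := hε.trans hερ
  set θ : ℂ → ℝ := fun z => cutoff ε (‖z‖ ^ 2) / Real.pi with hθdef
  have hθ : ContDiff ℝ ∞ θ := ((contDiff_cutoff ε).comp (contDiff_norm_sq ℝ)).div_const _
  have hθz : ∀ z, wirtingerBar (fun w => (θ w : ℂ)) z = -(mollifier ε z : ℂ) * z := by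
    intro z
    have h := wirtingerBar_radial (z := z) (f := fun t => cutoff ε t / Real.pi)
      (((contDiff_cutoff ε).differentiable (by simp) _).hasDerivAt.div_const _)
    rw [h, mollifier]
    push_cast
    ring
  set β : ℂ → ℂ := fun z => (θ z : ℂ) + z * v z with hβdef
  have hβ : ContDiff ℝ ∞ β := (contDiff_ofReal_comp hθ).add (contDiff_id.mul hv)
  have hsβ : tsupport β ⊆ Metric.closedBall 0 ε ∪ tsupport v := by
    refine closure_minimal (fun z hz => ?_)
      (Metric.isClosed_closedBall.union (isClosed_tsupport _))
    by_contra h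
    rw [mem_union, not_or, mem_closedBall_zero_iff, not_le] at h
    refine hz ?_
    have : ε ^ 2 ≤ ‖z‖ ^ 2 := by have := h.1.le; gcongr
    simp [hβdef, hθdef, cutoff_of_le hε this, image_eq_zero_of_notMem_tsupport h.2]
  have hβc : HasCompactSupport β :=
    ((isCompact_closedBall 0 ε).union hc).of_isClosed_subset (isClosed_tsupport _) hsβ
  have hβb : tsupport β ⊆ Metric.ball 0 ρ :=
    hsβ.trans (union_subset (Metric.closedBall_subset_ball hερ) hs)
  have hβz : ∀ z, wirtingerBar β z = z * (wirtingerBar v z - (mollifier ε z : ℂ)) := by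
    intro z
    have dv : DifferentiableAt ℝ v z := hv.differentiable (by simp) z
    rw [hβdef, wirtingerBar_add ((contDiff_ofReal_comp hθ).differentiable (by simp) z)
      (differentiableAt_fun_id.fun_mul dv), hθz, wirtingerBar_mul differentiableAt_fun_id dv,
      wirtingerBar_id]
    ring
  have cm : Continuous fun z => (mollifier ε z : ℂ) :=
    Complex.continuous_ofReal.comp (contDiff_mollifier ε).continuous
  have key := dual_inequality hφ hsub hβ hβc hβb
    ((contDiff_wirtingerBar hv).continuous.sub cm)
    ((hasCompactSupport_wirtingerBar hc).sub
      ((hasCompactSupport_mollifier hε).comp_left Complex.ofReal_zero)) hβz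
  have hβ0 : ‖β 0‖ ^ 2 = 1 / Real.pi ^ 2 := by
    simp [hβdef, hθdef, cutoff_zero, abs_of_pos Real.pi_pos]
  rw [hβ0] at key
  have e : ∀ z, ‖(mollifier ε z : ℂ) - wirtingerBar v z‖
      = ‖(wirtingerBar v - fun z => (mollifier ε z : ℂ)) z‖ := fun z => norm_sub_rev _ _
  simp_rw [e]
  rw [div_le_iff₀ (by positivity)]
  have hpi := Real.pi_pos
  calc Real.exp (φ 0) = Real.pi * (Real.pi * (Real.exp (φ 0) * (1 / Real.pi ^ 2))) := by
        field_simp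
    _ ≤ Real.pi * _ := mul_le_mul_of_nonneg_left key hpi.le
    _ = _ := by ring

end DualInequality

/-! ### From the distance estimate to a weakly holomorphic function -/

section Projection

theorem integral_norm_sq_eq {μ : Measure ℂ} (F : Lp ℂ 2 μ) : ∫ z, ‖F z‖ ^ 2 ∂μ = ‖F‖ ^ 2 := by
  have h : (inner ℂ F F : ℂ) = ((‖F‖ ^ 2 : ℝ) : ℂ) := by
    rw [inner_self_eq_norm_sq_to_K]; simp
  rw [L2.inner_def] at h
  have e : ∀ z, (inner ℂ (F z) (F z) : ℂ) = ((‖F z‖ ^ 2 : ℝ) : ℂ) := fun z => by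
    rw [inner_self_eq_norm_sq_to_K]; simp
  simp_rw [e] at h
  rw [integral_complex_ofReal] at h
  exact_mod_cast h

/-- The distance from a vector to a subspace is attained by a vector orthogonal to it. -/
theorem exists_orthogonal_of_le_norm_sub {H : Type*} [NormedAddCommGroup H]
    [InnerProductSpace ℂ H] [CompleteSpace H] (W : Submodule ℂ H) (x : H) {C : ℝ}
    (hC : ∀ w ∈ W, C ≤ ‖x - w‖ ^ 2) :
    ∃ y : H, (∀ w ∈ W, inner ℂ y w = 0) ∧ inner ℂ y x = ((‖y‖ ^ 2 : ℝ) : ℂ) ∧ C ≤ ‖y‖ ^ 2 := by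
  set K := W.topologicalClosure
  have : CompleteSpace K := W.isClosed_topologicalClosure.completeSpace_coe
  have hK : ∀ w ∈ K, C ≤ ‖x - w‖ ^ 2 := by
    have hcl : IsClosed {w : H | C ≤ ‖x - w‖ ^ 2} :=
      isClosed_le continuous_const (by fun_prop)
    have hsub : closure (W : Set H) ⊆ {w : H | C ≤ ‖x - w‖ ^ 2} :=
      closure_minimal (fun w hw => hC w hw) hcl
    intro w hw
    rw [← SetLike.mem_coe, Submodule.topologicalClosure_coe] at hw
    exact hsub hw
  have horth := K.sub_starProjection_mem_orthogonal x
  rw [Submodule.mem_orthogonal'] at horth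
  refine ⟨x - K.starProjection x, fun w hw => horth w (W.le_topologicalClosure hw), ?_,
    hK _ (K.starProjection_apply_mem x)⟩
  have h1 := horth _ (K.starProjection_apply_mem x)
  have h2 : (inner ℂ (x - K.starProjection x) (x - K.starProjection x) : ℂ)
      = ((‖x - K.starProjection x‖ ^ 2 : ℝ) : ℂ) := by
    rw [inner_self_eq_norm_sq_to_K]; simp
  rw [← h2]
  conv_rhs => rw [inner_sub_right, h1, sub_zero]

/-- Smooth functions with compact support in `D`. -/
def IsTest (D : Set ℂ) (v : ℂ → ℂ) : Prop :=
  ContDiff ℝ ∞ v ∧ HasCompactSupport v ∧ tsupport v ⊆ D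

theorem IsTest.add {D : Set ℂ} {v w : ℂ → ℂ} (hv : IsTest D v) (hw : IsTest D w) :
    IsTest D (fun z => v z + w z) :=
  ⟨hv.1.add hw.1, hv.2.1.add hw.2.1, (tsupport_add v w).trans (union_subset hv.2.2 hw.2.2)⟩

theorem IsTest.const_mul {D : Set ℂ} {v : ℂ → ℂ} (hv : IsTest D v) (c : ℂ) :
    IsTest D (fun z => c * v z) :=
  ⟨contDiff_const.mul hv.1, hv.2.1.mul_left, (tsupport_mul_subset_right).trans hv.2.2⟩

theorem isTest_zero (D : Set ℂ) : IsTest D (fun _ => 0) :=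
  ⟨contDiff_const, HasCompactSupport.zero, by
    rw [show (fun _ : ℂ => (0 : ℂ)) = 0 from rfl, tsupport_zero]; exact empty_subset _⟩

/-- The subspace of `L²(μ)` of the classes of `e^{φ/2} ∂v/∂z̄` with `v` a test function. -/
def wirtingerBarRange (D : Set ℂ) (φ : ℂ → ℝ) (μ : Measure ℂ) : Submodule ℂ (Lp ℂ 2 μ) where
  carrier := {F | ∃ v, IsTest D v ∧ F =ᵐ[μ] fun z => (Real.exp (φ z / 2) : ℂ) * wirtingerBar v z}
  add_mem' := by
    rintro F G ⟨v, hv, hF⟩ ⟨w, hw, hG⟩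
    refine ⟨_, hv.add hw, ?_⟩
    filter_upwards [hF, hG, Lp.coeFn_add F G] with z h1 h2 h3
    rw [h3, Pi.add_apply, h1, h2, wirtingerBar_add (hv.1.differentiable (by simp) z)
      (hw.1.differentiable (by simp) z), mul_add]
  zero_mem' := by
    refine ⟨_, isTest_zero D, ?_⟩
    filter_upwards [Lp.coeFn_zero ℂ 2 μ] with z h
    rw [h]
    simp [wirtingerBar]
  smul_mem' := by
    rintro c F ⟨v, hv, hF⟩
    refine ⟨_, hv.const_mul c, ?_⟩
    filter_upwards [hF, Lp.coeFn_smul c F] with z h1 h2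
    rw [h2, Pi.smul_apply, h1, wirtingerBar_const_mul c (hv.1.differentiable (by simp) z),
      smul_eq_mul]
    ring

theorem setIntegral_ball_of_eq_zero {E : Type*} [NormedAddCommGroup E] [NormedSpace ℝ E]
    {D : Set ℂ} {f : ℂ → E} (hf : ∀ z ∉ D, f z = 0) : ∫ z in D, f z = ∫ z, f z :=
  setIntegral_eq_integral_of_forall_compl_eq_zero hf

/-- A weakly holomorphic function on the disc of radius `ρ` with the sharp `L²` bound. -/
theorem exists_weakly_holomorphic {φ : ℂ → ℝ} {ρ ε : ℝ} (hε : 0 < ε) (hερ : ε < ρ)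
    (hφ : ContDiff ℝ ∞ φ) (hsub : ∀ z ∈ Metric.ball (0 : ℂ) ρ, 0 ≤ leviCoeff φ z) :
    ∃ (h : ℂ → ℂ) (N : ℝ), Integrable h ∧
      Integrable (fun z => ‖h z‖ ^ 2 * Real.exp (-φ z)) ∧
      (∀ v, IsTest (Metric.ball 0 ρ) v → ∫ z, h z * wirtingerBar v z = 0) ∧
      ∫ z, h z * (mollifier ε z : ℂ) = N ∧ ∫ z, ‖h z‖ ^ 2 * Real.exp (-φ z) = N ∧
      Real.exp (φ 0) / (Real.pi * ρ ^ 2) ≤ N := by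
  set D : Set ℂ := Metric.ball 0 ρ with hD
  have hDm : MeasurableSet D := measurableSet_ball
  set μ : Measure ℂ := volume.restrict D with hμ
  have : IsFiniteMeasure μ := ⟨by rw [hμ, Measure.restrict_apply_univ]; exact measure_ball_lt_top⟩
  have cφ := hφ.continuous
  have cE : Continuous fun z => (Real.exp (φ z / 2) : ℂ) := by fun_prop
  have cm : Continuous fun z => (mollifier ε z : ℂ) :=
    Complex.continuous_ofReal.comp (contDiff_mollifier ε).continuous
  have hmc : HasCompactSupport fun z => (mollifier ε z : ℂ) :=
    (hasCompactSupport_mollifier hε).comp_left Complex.ofReal_zero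
  have hmem : ∀ f : ℂ → ℂ, Continuous f → HasCompactSupport f →
      MemLp (fun z => (Real.exp (φ z / 2) : ℂ) * f z) 2 μ := fun f hf hc =>
    ((cE.mul hf).memLp_of_hasCompactSupport hc.mul_left).restrict _
  set W := wirtingerBarRange D φ μ with hW
  set g₀ : Lp ℂ 2 μ := (hmem _ cm hmc).toLp _ with hg₀
  have cg₀ : g₀ =ᵐ[μ] fun z => (Real.exp (φ z / 2) : ℂ) * (mollifier ε z : ℂ) :=
    MemLp.coeFn_toLp _
  have hexp : ∀ z, Real.exp (φ z / 2) ^ 2 = Real.exp (φ z) := fun z => by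
    rw [← Real.exp_nat_mul]; congr 1; push_cast; ring
  have hdist : ∀ w ∈ W, Real.exp (φ 0) / (Real.pi * ρ ^ 2) ≤ ‖g₀ - w‖ ^ 2 := by
    rintro w ⟨v, hv, hw⟩
    refine (mollifier_dual_inequality hε hερ hφ hsub hv.1 hv.2.1 hv.2.2).trans (le_of_eq ?_)
    rw [← integral_norm_sq_eq, ← setIntegral_ball_of_eq_zero (D := D)]
    · refine integral_congr_ae ?_
      filter_upwards [Lp.coeFn_sub g₀ w, cg₀, hw] with z h1 h2 h3
      rw [h1, Pi.sub_apply, h2, h3, ← mul_sub, norm_mul, mul_pow, Complex.norm_real,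
        Real.norm_of_nonneg (Real.exp_pos _).le, hexp]
    · intro z hz
      have h1 : mollifier ε z = 0 := mollifier_eq_zero hε (by
        rw [hD, mem_ball_zero_iff, not_lt] at hz
        linarith)
      have h2 : wirtingerBar v z = 0 :=
        image_eq_zero_of_notMem_tsupport fun h => hz (hv.2.2 (tsupport_wirtingerBar_subset h))
      simp [h1, h2]
  obtain ⟨F, hF1, hF2, hF3⟩ := exists_orthogonal_of_le_norm_sub W g₀ hdist
  -- Integration against h = F̄ e^{φ/2} on D is the inner product with F. Orthogonality to the range
  -- gives ∂̄h = 0 weakly, and pairing with the mollifier gives ‖F‖², which also equals ∫ |h|²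
  -- e^{-φ}.
  have hpair : ∀ (G : Lp ℂ 2 μ) (f : ℂ → ℂ),
      (G =ᵐ[μ] fun z => (Real.exp (φ z / 2) : ℂ) * f z) →
      ∫ z, D.indicator (fun z => conj (F z) * (Real.exp (φ z / 2) : ℂ)) z * f z = inner ℂ F G := by
    intro G f hG
    rw [L2.inner_def, ← setIntegral_ball_of_eq_zero (D := D)]
    · refine integral_congr_ae ?_
      filter_upwards [hG, ae_restrict_mem hDm] with z h1 h2
      rw [indicator_of_mem h2, h1]
      simp [RCLike.inner_apply]
      ring
    · intro z hz
      simp [indicator_of_notMem hz]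
  have hFL := Lp.memLp F
  have hsq : Integrable (fun z => ‖F z‖ ^ 2) μ := hFL.integrable_norm_pow (by norm_num)
  have hsqe : (fun z => ‖D.indicator (fun z => conj (F z) * (Real.exp (φ z / 2) : ℂ)) z‖ ^ 2
      * Real.exp (-φ z)) = D.indicator fun z => ‖F z‖ ^ 2 := by
    funext z
    by_cases hz : z ∈ D
    · rw [indicator_of_mem hz, indicator_of_mem hz, norm_mul, mul_pow, Complex.norm_real,
        Real.norm_of_nonneg (Real.exp_pos _).le, hexp, RCLike.norm_conj, mul_assoc,
        ← Real.exp_add]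
      simp
    · simp [indicator_of_notMem hz]
  refine ⟨D.indicator fun z => conj (F z) * (Real.exp (φ z / 2) : ℂ), ‖F‖ ^ 2, ?_, ?_, ?_, ?_, ?_,
    hF3⟩
  · rw [integrable_indicator_iff hDm]
    obtain ⟨C, hC⟩ := (isCompact_closedBall (0 : ℂ) ρ).exists_bound_of_continuousOn cE.continuousOn
    have hFi : Integrable (fun z => conj (F z)) μ := by
      have := hFL.integrable (by norm_num)
      exact (Complex.conjCLE.toContinuousLinearMap.integrable_comp this)
    refine hFi.mul_bdd (c := C) cE.aestronglyMeasurable ?_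
    filter_upwards [ae_restrict_mem hDm] with z hz
    exact hC z (Metric.ball_subset_closedBall hz)
  · rw [hsqe, integrable_indicator_iff hDm]
    exact hsq
  · intro v hv
    have hm := hmem _ (contDiff_wirtingerBar hv.1).continuous (hasCompactSupport_wirtingerBar hv.2.1)
    rw [hpair (hm.toLp _) _ hm.coeFn_toLp]
    exact hF1 _ ⟨v, hv, hm.coeFn_toLp⟩
  · rw [hpair g₀ _ cg₀, hF2]
  · rw [hsqe, integral_indicator hDm, ← integral_norm_sq_eq]

end Projection

/-! ### Regularising the weak solution to a holomorphic function -/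

section Mollification

/-- The mollification of `h` at scale `ε`. -/
def mollify (ε : ℝ) (h : ℂ → ℂ) (z : ℂ) : ℂ := ∫ t, h t * (mollifier ε (z - t) : ℂ)

variable {ε : ℝ} {h : ℂ → ℂ}

theorem isTest_mollifier_sub (hε : 0 < ε) {z : ℂ} {D : Set ℂ} (hD : Metric.closedBall z ε ⊆ D) :
    IsTest D fun t => (mollifier ε (z - t) : ℂ) := by
  have hs : tsupport (fun t => (mollifier ε (z - t) : ℂ)) ⊆ Metric.closedBall z ε := by
    refine closure_minimal (fun t ht => ?_) Metric.isClosed_closedBall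
    rw [Metric.mem_closedBall, dist_comm, dist_eq_norm]
    by_contra hn
    exact ht (by simp [mollifier_eq_zero hε (not_le.1 hn)])
  exact ⟨(contDiff_ofReal_comp (contDiff_mollifier ε)).comp (contDiff_const.sub contDiff_id),
    (isCompact_closedBall z ε).of_isClosed_subset (isClosed_tsupport _) hs, hs.trans hD⟩

theorem fderiv_comp_const_sub_apply {m : ℂ → ℂ} (hm : ContDiff ℝ ∞ m) (z t v : ℂ) :
    fderiv ℝ (fun t => m (z - t)) t v = -fderiv ℝ m (z - t) v := by
  have h1 := (hm.differentiable (by simp) (z - t)).hasFDerivAt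
  have h2 := h1.comp t ((hasFDerivAt_id (𝕜 := ℝ) t).const_sub z)
  have h3 : HasFDerivAt (fun t => m (z - t))
    ((fderiv ℝ m (z - t)).comp (-ContinuousLinearMap.id ℝ ℂ)) t := h2
  rw [h3.fderiv]
  simp

/-- The translated mollifier is itself a test function, so weak holomorphy of h is the
Cauchy–Riemann equation for the convolution at z. -/
theorem differentiableAt_mollify (hε : 0 < ε) (hh : Integrable h) {D : Set ℂ}
    (hw : ∀ v, IsTest D v → ∫ z, h z * wirtingerBar v z = 0) {z : ℂ}
    (hz : Metric.closedBall z ε ⊆ D) : DifferentiableAt ℂ (mollify ε h) z := by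
  set m : ℂ → ℂ := fun z => (mollifier ε z : ℂ) with hmdef
  have hm : ContDiff ℝ ∞ m := contDiff_ofReal_comp (contDiff_mollifier ε)
  have hmc : HasCompactSupport m := (hasCompactSupport_mollifier hε).comp_left Complex.ofReal_zero
  have hloc : LocallyIntegrable h volume := hh.locallyIntegrable
  have hd := hmc.hasFDerivAt_convolution_right (ContinuousLinearMap.mul ℝ ℂ) hloc
    (hm.of_le (by simp)) z
  have e : (h ⋆[ContinuousLinearMap.mul ℝ ℂ, volume] m) = mollify ε h := rfl
  rw [e] at hd
  have happ : ∀ v : ℂ, fderiv ℝ (mollify ε h) z v = ∫ t, h t * fderiv ℝ m (z - t) v := by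
    intro v
    rw [hd.fderiv, convolution_precompR_apply _ hloc (hmc.fderiv ℝ)
      (hm.continuous_fderiv (by simp))]
    rfl
  have hint : ∀ v : ℂ, Integrable fun t => h t * fderiv ℝ m (z - t) v := fun v =>
    (((hmc.fderiv_apply ℝ v).convolutionExists_right (ContinuousLinearMap.mul ℝ ℂ) hloc
      (contDiff_fderiv_apply_const hm v).continuous) z)
  have h0 : ∫ t, h t * wirtingerBar (fun t => m (z - t)) t = 0 :=
    hw _ (isTest_mollifier_sub hε hz)
  have e2 : ∀ t, h t * wirtingerBar (fun t => m (z - t)) t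
      = (-(1 / 2)) * (h t * fderiv ℝ m (z - t) 1)
        + (-(1 / 2) * Complex.I) * (h t * fderiv ℝ m (z - t) Complex.I) := by
    intro t
    rw [wirtingerBar, fderiv_comp_const_sub_apply hm, fderiv_comp_const_sub_apply hm]
    ring
  rw [integral_congr_ae (Eventually.of_forall e2), integral_add ((hint 1).const_mul _)
    ((hint _).const_mul _), integral_const_mul, integral_const_mul, ← happ, ← happ] at h0
  rw [differentiableAt_complex_iff_differentiableAt_real]
  refine ⟨hd.differentiableAt, ?_⟩
  rw [smul_eq_mul]
  have h1 : fderiv ℝ (mollify ε h) z 1 = -Complex.I * fderiv ℝ (mollify ε h) z Complex.I := by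
    linear_combination (-2) * h0
  rw [h1]
  linear_combination (fderiv ℝ (mollify ε h) z Complex.I) * Complex.I_mul_I

theorem integral_mollifier_sub (hε : 0 < ε) (z : ℂ) : ∫ t, mollifier ε (z - t) = 1 := by
  rw [integral_sub_left_eq_self (fun t => mollifier ε t), integral_mollifier hε]

/-- Nonnegativity of the variance of f under the probability density M. -/
theorem sq_integral_mul_le {f M : ℂ → ℝ} (hM : ∀ t, 0 ≤ M t) (iM : Integrable M)
    (hM1 : ∫ t, M t = 1) (i1 : Integrable fun t => f t * M t)
    (i2 : Integrable fun t => f t ^ 2 * M t) :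
    (∫ t, f t * M t) ^ 2 ≤ ∫ t, f t ^ 2 * M t := by
  set c := ∫ t, f t * M t with hc
  have h0 : 0 ≤ ∫ t, (f t - c) ^ 2 * M t :=
    integral_nonneg fun t => mul_nonneg (sq_nonneg _) (hM t)
  have e : ∀ t, (f t - c) ^ 2 * M t = f t ^ 2 * M t - (2 * c) * (f t * M t) + c ^ 2 * M t :=
    fun t => by ring
  simp_rw [e] at h0
  have i3 := i1.const_mul (2 * c)
  have i4 : Integrable fun t => f t ^ 2 * M t - 2 * c * (f t * M t) := i2.sub i3
  rw [integral_add i4 (iM.const_mul _), integral_sub i2 i3,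
    integral_const_mul, integral_const_mul, hM1, ← hc] at h0
  linarith

/-- Jensen for the mollifier, the weight being moved from z to t at the cost of its oscillation
factor C over distance ε. -/
theorem norm_sq_mollify_mul_le (hε : 0 < ε) (hh : Integrable h) {φ : ℂ → ℝ} (cφ : Continuous φ)
    (hH : Integrable fun z => ‖h z‖ ^ 2 * Real.exp (-φ z)) {C : ℝ}
    {z : ℂ} (hC : ∀ t, ‖z - t‖ ≤ ε → Real.exp (-φ z) ≤ C * Real.exp (-φ t)) :
    ‖mollify ε h z‖ ^ 2 * Real.exp (-φ z)
      ≤ C * ∫ t, (‖h t‖ ^ 2 * Real.exp (-φ t)) * mollifier ε (z - t) := by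
  have cm : Continuous fun t => mollifier ε (z - t) :=
    (contDiff_mollifier ε).continuous.comp (by fun_prop)
  have hmc : HasCompactSupport fun t => mollifier ε (z - t) := by
    have := (isTest_mollifier_sub hε (subset_refl (Metric.closedBall z ε))).2.1
    exact this.mono' fun t ht => subset_tsupport _ (by simpa using ht)
  have iM : Integrable fun t => mollifier ε (z - t) := cm.integrable_of_hasCompactSupport hmc
  obtain ⟨B, hB⟩ := hmc.exists_bound_of_continuous cm
  have i1 : Integrable fun t => ‖h t‖ * mollifier ε (z - t) :=
    hh.norm.mul_bdd (c := B) cm.aestronglyMeasurable (Eventually.of_forall hB)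
  have i3 : Integrable fun t => (‖h t‖ ^ 2 * Real.exp (-φ t)) * mollifier ε (z - t) :=
    hH.mul_bdd (c := B) cm.aestronglyMeasurable (Eventually.of_forall hB)
  have cM2 : Continuous fun t => Real.exp (φ t) * mollifier ε (z - t) :=
    (Real.continuous_exp.comp cφ).mul cm
  obtain ⟨B', hB'⟩ := hmc.mul_left (f := fun t => Real.exp (φ t)) |>.exists_bound_of_continuous cM2
  have i2 : Integrable fun t => ‖h t‖ ^ 2 * mollifier ε (z - t) := by
    refine (hH.mul_bdd (c := B') cM2.aestronglyMeasurable (Eventually.of_forall hB')).congr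
      (Eventually.of_forall fun t => ?_)
    have : Real.exp (-φ t) * Real.exp (φ t) = 1 := by rw [← Real.exp_add]; simp
    linear_combination (‖h t‖ ^ 2 * mollifier ε (z - t)) * this
  have h1 : ‖mollify ε h z‖ ≤ ∫ t, ‖h t‖ * mollifier ε (z - t) := by
    refine (norm_integral_le_integral_norm _).trans (le_of_eq ?_)
    refine integral_congr_ae (Eventually.of_forall fun t => ?_)
    simp only [norm_mul, Complex.norm_real, Real.norm_of_nonneg (mollifier_nonneg _ _)]
  have h2 := sq_integral_mul_le (f := fun t => ‖h t‖) (fun t => mollifier_nonneg ε (z - t)) iM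
    (integral_mollifier_sub hε z) i1 i2
  have h3 : ‖mollify ε h z‖ ^ 2 ≤ ∫ t, ‖h t‖ ^ 2 * mollifier ε (z - t) :=
    (pow_le_pow_left₀ (norm_nonneg _) h1 2).trans h2
  refine (mul_le_mul_of_nonneg_right h3 (Real.exp_pos _).le).trans ?_
  rw [← integral_mul_const, ← integral_const_mul]
  refine integral_mono (i2.mul_const _) (i3.const_mul _) fun t => ?_
  simp only
  by_cases ht : ‖z - t‖ ≤ ε
  · have hm := mollifier_nonneg ε (z - t)
    calc _ = (‖h t‖ ^ 2 * mollifier ε (z - t)) * Real.exp (-φ z) := rfl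
      _ ≤ (‖h t‖ ^ 2 * mollifier ε (z - t)) * (C * Real.exp (-φ t)) := by
          gcongr
          exact hC t ht
      _ = _ := by ring
  · simp [mollifier_eq_zero hε (not_le.1 ht)]

theorem mollify_mem_bergmanSpace {r ρ N C : ℝ} (hε : 0 < ε) (hr : r + ε ≤ ρ) (hh : Integrable h)
    {φ : ℂ → ℝ} (cφ : Continuous φ) (hH : Integrable fun z => ‖h z‖ ^ 2 * Real.exp (-φ z))
    (hN : ∫ z, ‖h z‖ ^ 2 * Real.exp (-φ z) = N)
    (hC : ∀ z t, ‖z - t‖ ≤ ε → Real.exp (-φ z) ≤ C * Real.exp (-φ t)) (hC0 : 0 ≤ C)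
    (hw : ∀ v, IsTest (Metric.ball 0 ρ) v → ∫ z, h z * wirtingerBar v z = 0) :
    mollify ε h ∈ bergmanSpace (Metric.ball 0 r) φ ∧
      normSq (Metric.ball 0 r) φ (mollify ε h) ≤ C * N := by
  have hdiff : ∀ z ∈ Metric.ball (0 : ℂ) r, DifferentiableAt ℂ (mollify ε h) z := by
    intro z hz
    refine differentiableAt_mollify hε hh hw fun t ht => ?_
    rw [mem_ball_zero_iff] at hz ⊢
    rw [Metric.mem_closedBall, dist_eq_norm] at ht
    have := norm_le_norm_add_norm_sub' t z
    linarith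
  have hdo : DifferentiableOn ℂ (mollify ε h) (Metric.ball 0 r) := fun z hz =>
    (hdiff z hz).differentiableWithinAt
  have hmi : Integrable (mollifier ε) :=
    (contDiff_mollifier ε).continuous.integrable_of_hasCompactSupport
      (hasCompactSupport_mollifier hε)
  have iconv := hH.integrable_convolution (ContinuousLinearMap.mul ℝ ℝ) hmi
  -- The mollifier has mass 1, so convolution preserves the total integral N.
  have hconv := integral_convolution (ContinuousLinearMap.mul ℝ ℝ) hH hmi
  rw [integral_mollifier hε, hN] at hconv
  have econv : ((fun z => ‖h z‖ ^ 2 * Real.exp (-φ z)) ⋆[ContinuousLinearMap.mul ℝ ℝ, volume]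
      mollifier ε)
      = fun z => ∫ t, (‖h t‖ ^ 2 * Real.exp (-φ t)) * mollifier ε (z - t) := rfl
  rw [econv] at iconv hconv
  have hle := fun z => norm_sq_mollify_mul_le hε hh cφ hH (hC z)
  have hi : IntegrableOn (fun z => ‖mollify ε h z‖ ^ 2 * Real.exp (-φ z)) (Metric.ball 0 r) := by
    refine Integrable.mono' (iconv.const_mul C).integrableOn ?_ (Eventually.of_forall fun z => ?_)
    · refine ContinuousOn.aestronglyMeasurable ?_ measurableSet_ball
      exact (hdo.continuousOn.norm.pow 2).mul (Real.continuous_exp.comp cφ.neg).continuousOn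
    · rw [Real.norm_of_nonneg (by positivity)]
      exact hle z
  refine ⟨⟨hdo, hi⟩, ?_⟩
  have hpos : ∀ z, 0 ≤ C * ∫ t, (‖h t‖ ^ 2 * Real.exp (-φ t)) * mollifier ε (z - t) := fun z =>
    mul_nonneg hC0 (integral_nonneg fun t => mul_nonneg (by positivity) (mollifier_nonneg _ _))
  calc normSq (Metric.ball 0 r) φ (mollify ε h)
      ≤ ∫ z in Metric.ball 0 r,
          C * ∫ t, (‖h t‖ ^ 2 * Real.exp (-φ t)) * mollifier ε (z - t) :=
        integral_mono hi (iconv.const_mul C).integrableOn hle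
    _ ≤ ∫ z, C * ∫ t, (‖h t‖ ^ 2 * Real.exp (-φ t)) * mollifier ε (z - t) :=
        setIntegral_le_integral (iconv.const_mul C) (Eventually.of_forall hpos)
    _ = C * N := by rw [integral_const_mul, hconv]; simp

/-- Using one and the same ε for the duality and the smoothing makes this value exactly N. -/
theorem mollify_zero : mollify ε h 0 = ∫ t, h t * (mollifier ε t : ℂ) := by
  simp [mollify, mollifier_neg]

/-- Extension from the origin with almost sharp constant, for a weight on the whole plane. -/
theorem exists_mem_bergmanSpace_of_subharmonic {φ : ℂ → ℝ} {r ρ η : ℝ} (hr : 0 < r) (hrρ : r < ρ)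
    (hη : 1 < η) (hφ : ContDiff ℝ ∞ φ) (hφc : HasCompactSupport φ)
    (hsub : ∀ z ∈ Metric.ball (0 : ℂ) ρ, 0 ≤ leviCoeff φ z) :
    ∃ f ∈ bergmanSpace (Metric.ball 0 r) φ, ∃ N : ℝ, f 0 = N ∧
      normSq (Metric.ball 0 r) φ f ≤ η * N ∧ Real.exp (φ 0) / (Real.pi * ρ ^ 2) ≤ N := by
  -- Uniform continuity makes φ vary by less than log η over distance ε, so smoothing costs only the
  -- factor η in the norm.
  have huc := hφc.uniformContinuous_of_continuous hφ.continuous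
  obtain ⟨ε₀, hε₀, hd⟩ := Metric.uniformContinuous_iff.1 huc (Real.log η) (Real.log_pos hη)
  set ε := min (ε₀ / 2) ((ρ - r) / 2) with hεdef
  have hε : 0 < ε := lt_min (by linarith) (by linarith)
  have hε1 : ε < ε₀ := (min_le_left _ _).trans_lt (by linarith)
  have hε2 : ε ≤ (ρ - r) / 2 := min_le_right _ _
  obtain ⟨h, N, hh, hH, hw, hm, hN, hC⟩ :=
    exists_weakly_holomorphic hε (show ε < ρ by linarith) hφ hsub
  have hexp : ∀ z t, ‖z - t‖ ≤ ε → Real.exp (-φ z) ≤ η * Real.exp (-φ t) := by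
    intro z t hzt
    have h1 := hd (a := z) (b := t) (by rw [dist_eq_norm]; exact hzt.trans_lt hε1)
    rw [Real.dist_eq] at h1
    have h2 := (abs_lt.1 h1).1
    calc Real.exp (-φ z) ≤ Real.exp (Real.log η + -φ t) := Real.exp_le_exp.2 (by linarith)
      _ = η * Real.exp (-φ t) := by rw [Real.exp_add, Real.exp_log (by linarith)]
  have hmem := mollify_mem_bergmanSpace hε (show r + ε ≤ ρ by linarith) hh hφ.continuous hH hN hexp
    (by linarith) hw
  exact ⟨_, hmem.1, N, by rw [mollify_zero, hm], hmem.2, hC⟩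

end Mollification

/-! ### Mean value properties with radial weights -/

section MeanValue

/-- Averaging an integrable function over rotations does not change its integral. -/
theorem integral_eq_integral_circleAverage {H : ℂ → ℂ} (hH : Integrable H) :
    ∫ z, H z = ∫ z, Real.circleAverage (fun u => H (z * u)) 0 1 := by
  set ν : Measure ℝ := volume.restrict (Ioc 0 (2 * Real.pi)) with hν
  have hpi : (0 : ℝ) ≤ 2 * Real.pi := by positivity
  have : IsFiniteMeasure ν := ⟨by
    rw [hν, Measure.restrict_apply_univ]; exact measure_Ioc_lt_top⟩
  have hνr : ν.real univ = 2 * Real.pi := by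
    rw [hν, measureReal_restrict_apply_univ, Real.volume_real_Ioc_of_le hpi]; simp
  have hrot : ∀ θ : ℝ, MeasurePreserving (fun z : ℂ => z * circleMap 0 1 θ) volume volume := by
    intro θ
    have e : (fun z : ℂ => z * circleMap 0 1 θ) = rotation (Circle.exp θ) := by
      funext z
      simp [rotation_apply, circleMap, mul_comm]
    rw [e]
    exact (rotation (Circle.exp θ)).measurePreserving
  -- Fubini on angle × plane: integrating first in z gives 2π∫H by rotation invariance, first in the
  -- angle gives the circle averages.
  have hmp : MeasurePreserving (fun p : ℝ × ℂ => (p.1, p.2 * circleMap 0 1 p.1))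
      (ν.prod volume) (ν.prod volume) := by
    refine (MeasurePreserving.id ν).skew_product (g := fun θ z => z * circleMap 0 1 θ) ?_
      (Eventually.of_forall fun θ => (hrot θ).map_eq)
    have : Continuous (Function.uncurry fun (θ : ℝ) (z : ℂ) => z * circleMap 0 1 θ) := by
      simp only [Function.uncurry_def, circleMap]
      fun_prop
    exact this.measurable
  have hint : Integrable (fun p : ℝ × ℂ => H (p.2 * circleMap 0 1 p.1)) (ν.prod volume) :=
    hmp.integrable_comp_of_integrable (g := fun p : ℝ × ℂ => H p.2) (hH.comp_snd ν)
  have h1 : ∫ p, H (p.2 * circleMap 0 1 p.1) ∂(ν.prod volume) = (2 * Real.pi) • ∫ z, H z := by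
    rw [integral_prod _ hint]
    have : ∀ θ : ℝ, ∫ z, H (z * circleMap 0 1 θ) = ∫ z, H z := fun θ => by
      rw [← integral_map (φ := fun z : ℂ => z * circleMap 0 1 θ) (hrot θ).aemeasurable
        (by rw [(hrot θ).map_eq]; exact hH.aestronglyMeasurable), (hrot θ).map_eq]
    simp_rw [this]
    rw [integral_const, hνr]
  have h2 : ∫ p, H (p.2 * circleMap 0 1 p.1) ∂(ν.prod volume)
      = (2 * Real.pi) • ∫ z, Real.circleAverage (fun u => H (z * u)) 0 1 := by
    rw [integral_prod_symm _ hint, ← integral_smul]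
    refine integral_congr_ae (Eventually.of_forall fun z => ?_)
    simp only [Real.circleAverage]
    rw [smul_inv_smul₀ (by positivity), intervalIntegral.integral_of_le hpi]
  have h3 := h1.symm.trans h2
  exact smul_right_injective ℂ (by positivity : (2 * Real.pi) ≠ 0) h3

/-- Rotations fix the weight and the disc, and for fixed z in the disc the average of u ↦ F(zu) over
the unit circle is F(0). -/
theorem setIntegral_mul_radial_eq {F : ℂ → ℂ} {W : ℝ → ℝ} {r : ℝ}
    (hF : DifferentiableOn ℂ F (Metric.ball 0 r))
    (hi : IntegrableOn (fun z => F z * (W ‖z‖ : ℂ)) (Metric.ball 0 r)) :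
    ∫ z in Metric.ball 0 r, F z * (W ‖z‖ : ℂ)
      = F 0 * ((∫ z in Metric.ball (0 : ℂ) r, W ‖z‖ : ℝ) : ℂ) := by
  have hm : MeasurableSet (Metric.ball (0 : ℂ) r) := measurableSet_ball
  rw [← integral_indicator hm, integral_eq_integral_circleAverage
    ((integrable_indicator_iff hm).2 hi), ← integral_complex_ofReal, ← integral_const_mul,
    ← integral_indicator hm]
  refine integral_congr_ae (Eventually.of_forall fun z => ?_)
  simp only
  have e : Real.circleAverage (fun u => (Metric.ball (0 : ℂ) r).indicator
      (fun z => F z * (W ‖z‖ : ℂ)) (z * u)) 0 1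
      = Real.circleAverage (fun u => (Metric.ball (0 : ℂ) r).indicator
        (fun y => F (y * u) * (W ‖z‖ : ℂ)) z) 0 1 := by
    refine Real.circleAverage_congr_sphere fun u hu => ?_
    have hu1 : ‖u‖ = 1 := by simpa using hu
    by_cases hz : z ∈ Metric.ball (0 : ℂ) r
    · have hzu : z * u ∈ Metric.ball (0 : ℂ) r := by
        rw [mem_ball_zero_iff] at hz ⊢
        rwa [norm_mul, hu1, mul_one]
      simp only [indicator_of_mem hz, indicator_of_mem hzu, norm_mul, hu1, mul_one]
    · have hzu : z * u ∉ Metric.ball (0 : ℂ) r := by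
        rw [mem_ball_zero_iff] at hz ⊢
        rwa [norm_mul, hu1, mul_one]
      simp only [indicator_of_notMem hz, indicator_of_notMem hzu]
  rw [e]
  by_cases hz : z ∈ Metric.ball (0 : ℂ) r
  · simp only [indicator_of_mem hz]
    have hmaps : MapsTo (fun u => z * u) (Metric.closedBall (0 : ℂ) |1|) (Metric.ball 0 r) := by
      intro u hu
      rw [mem_closedBall_zero_iff, abs_one] at hu
      rw [mem_ball_zero_iff] at hz ⊢
      rw [norm_mul]
      nlinarith [norm_nonneg z, norm_nonneg u]
    have hd : DifferentiableOn ℂ (fun u => F (z * u) * (W ‖z‖ : ℂ))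
        (Metric.closedBall (0 : ℂ) |1|) :=
      ((hF.comp ((differentiable_const z).mul differentiable_id).differentiableOn hmaps)).mul_const _
    have hd' : DiffContOnCl ℂ (fun u => F (z * u) * (W ‖z‖ : ℂ)) (Metric.ball (0 : ℂ) |1|) :=
      DifferentiableOn.diffContOnCl (hd.mono (by
        rw [closure_ball _ (by simp)]))
    rw [hd'.circleAverage]
    simp
  · simp only [indicator_of_notMem hz]
    simp [Real.circleAverage]

/-- Integrate 2 Re(conj F(0) · F) - |F(0)|² ≤ |F|² against W; the mean value identity evaluates the
left side. -/
theorem sub_mean_value_radial {F : ℂ → ℂ} {W : ℝ → ℝ} {r : ℝ}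
    (hF : DifferentiableOn ℂ F (Metric.ball 0 r)) (hW : ∀ t, 0 ≤ t → t < r → 0 ≤ W t)
    (hWc : Continuous W) (hi : IntegrableOn (fun z => ‖F z‖ ^ 2) (Metric.ball 0 r)) :
    ‖F 0‖ ^ 2 * ∫ z in Metric.ball (0 : ℂ) r, W ‖z‖
      ≤ ∫ z in Metric.ball 0 r, ‖F z‖ ^ 2 * W ‖z‖ := by
  have hm : MeasurableSet (Metric.ball (0 : ℂ) r) := measurableSet_ball
  have : IsFiniteMeasure (volume.restrict (Metric.ball (0 : ℂ) r)) :=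
    ⟨by rw [Measure.restrict_apply_univ]; exact measure_ball_lt_top⟩
  have cW : Continuous fun z : ℂ => W ‖z‖ := hWc.comp continuous_norm
  obtain ⟨B, hB⟩ := (isCompact_closedBall (0 : ℂ) r).exists_bound_of_continuousOn cW.continuousOn
  have hB' : ∀ᵐ z ∂(volume.restrict (Metric.ball (0 : ℂ) r)), ‖W ‖z‖‖ ≤ B := by
    filter_upwards [ae_restrict_mem hm] with z hz
    exact hB z (Metric.ball_subset_closedBall hz)
  have i2 : IntegrableOn (fun z => ‖F z‖ ^ 2 * W ‖z‖) (Metric.ball 0 r) :=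
    Integrable.mul_bdd (c := B) hi cW.aestronglyMeasurable hB'
  have iW : IntegrableOn (fun z : ℂ => W ‖z‖) (Metric.ball 0 r) :=
    Integrable.of_bound cW.aestronglyMeasurable B hB'
  have iF : IntegrableOn F (Metric.ball 0 r) := by
    refine Integrable.mono' (hi.add (integrable_const (1 : ℝ)))
      (hF.continuousOn.aestronglyMeasurable hm) (Eventually.of_forall fun z => ?_)
    simp only [Pi.add_apply]
    nlinarith [sq_nonneg (‖F z‖ - 1), norm_nonneg (F z)]
  have iFW : IntegrableOn (fun z => F z * (W ‖z‖ : ℂ)) (Metric.ball 0 r) := by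
    refine Integrable.mul_bdd (c := B) iF
      (Complex.continuous_ofReal.comp cW).aestronglyMeasurable ?_
    filter_upwards [hB'] with z hz
    rwa [Complex.norm_real]
  have h1 := setIntegral_mul_radial_eq hF iFW
  have h2 : ∫ z in Metric.ball 0 r, (conj (F 0) * (F z * (W ‖z‖ : ℂ))).re
      = ‖F 0‖ ^ 2 * ∫ z in Metric.ball (0 : ℂ) r, W ‖z‖ := by
    have h3 : ∫ z in Metric.ball 0 r, (conj (F 0) * (F z * (W ‖z‖ : ℂ))).re
        = (∫ z in Metric.ball 0 r, conj (F 0) * (F z * (W ‖z‖ : ℂ))).re :=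
      integral_re (iFW.const_mul _)
    rw [h3, integral_const_mul, h1, ← mul_assoc, Complex.conj_mul']
    norm_cast
  have i3 : IntegrableOn (fun z => (conj (F 0) * (F z * (W ‖z‖ : ℂ))).re) (Metric.ball 0 r) :=
    (iFW.const_mul (conj (F 0))).re
  have hmain : ∫ z in Metric.ball 0 r,
      (2 * (conj (F 0) * (F z * (W ‖z‖ : ℂ))).re - ‖F 0‖ ^ 2 * W ‖z‖)
      ≤ ∫ z in Metric.ball 0 r, ‖F z‖ ^ 2 * W ‖z‖ := by
    refine setIntegral_mono_on ((i3.const_mul 2).sub (iW.const_mul _)) i2 hm fun z hz => ?_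
    have hw : 0 ≤ W ‖z‖ := hW _ (norm_nonneg _) (mem_ball_zero_iff.1 hz)
    have h4 : (conj (F 0) * (F z * (W ‖z‖ : ℂ))).re = (conj (F 0) * F z).re * W ‖z‖ := by
      rw [← mul_assoc, mul_comm, Complex.re_ofReal_mul, mul_comm]
    have h5 : 2 * (conj (F 0) * F z).re ≤ ‖F z‖ ^ 2 + ‖F 0‖ ^ 2 := by
      have h6 := Complex.re_le_norm (conj (F 0) * F z)
      rw [norm_mul, RCLike.norm_conj] at h6
      nlinarith [sq_nonneg (‖F z‖ - ‖F 0‖)]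
    rw [h4]
    nlinarith
  rw [integral_sub (i3.const_mul 2) (iW.const_mul _), integral_const_mul, integral_const_mul, h2]
    at hmain
  linarith

theorem setIntegral_ball_quadratic {A B r : ℝ} (hr : 0 < r) :
    ∫ z in Metric.ball (0 : ℂ) r, (A + B * ‖z‖ ^ 2)
      = Real.pi * r ^ 2 * (A + B * r ^ 2 / 2) := by
  rw [← integral_indicator measurableSet_ball]
  have e : ∀ z : ℂ, (Metric.ball (0 : ℂ) r).indicator (fun z => A + B * ‖z‖ ^ 2) z
      = (Iio r).indicator (fun y => A + B * y ^ 2) ‖z‖ := by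
    intro z
    by_cases hz : ‖z‖ < r
    · rw [indicator_of_mem (mem_ball_zero_iff.2 hz), indicator_of_mem (mem_Iio.2 hz)]
    · rw [indicator_of_notMem (by rwa [mem_ball_zero_iff]), indicator_of_notMem (by rwa [mem_Iio])]
  simp_rw [e]
  rw [integral_fun_norm_addHaar volume (fun y => (Iio r).indicator (fun y => A + B * y ^ 2) y)]
  have hv : volume.real (Metric.ball (0 : ℂ) 1) = Real.pi := by
    simp [Measure.real, Complex.volume_ball]
  have e2 : ∀ y : ℝ, y ^ (Module.finrank ℝ ℂ - 1) • (Iio r).indicator (fun y => A + B * y ^ 2) y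
      = (Iio r).indicator (fun y => A * y + B * y ^ 3) y := by
    intro y
    by_cases hy : y < r
    · simp [indicator_of_mem (mem_Iio.2 hy)]; ring
    · simp [hy]
  simp_rw [e2]
  rw [setIntegral_indicator measurableSet_Iio, Ioi_inter_Iio, ← integral_Ioc_eq_integral_Ioo,
    ← intervalIntegral.integral_of_le hr.le, intervalIntegral.integral_add
      (Continuous.intervalIntegrable (by fun_prop) _ _)
      (Continuous.intervalIntegrable (by fun_prop) _ _), intervalIntegral.integral_const_mul,
    intervalIntegral.integral_const_mul, integral_id, integral_pow, hv]
  simp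
  ring

end MeanValue

/-! ### Competitors for the Bergman kernel and translation to the origin -/

section Kernel

/-- Each element of the Bergman space bounds the Bergman kernel from below. -/
theorem le_bergmanKernel {D : Set ℂ} {φ : ℂ → ℝ} {a : ℂ} {f : ℂ → ℂ} {M : ℝ}
    (hb : BddAbove {t : ℝ | ∃ f ∈ bergmanSpace D φ, normSq D φ f ≤ 1 ∧
      t = ‖f a‖ ^ 2 * Real.exp (-φ a)})
    (hf : f ∈ bergmanSpace D φ) (hM : 0 < M) (hfM : normSq D φ f ≤ M) :
    ‖f a‖ ^ 2 * Real.exp (-φ a) / M ≤ bergmanKernel D φ a := by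
  have hn : ∀ z, ‖((1 / √M : ℝ) : ℂ) * f z‖ ^ 2 = 1 / M * ‖f z‖ ^ 2 := fun z => by
    rw [norm_mul, mul_pow, Complex.norm_real, Real.norm_eq_abs, sq_abs, div_pow, one_pow,
      Real.sq_sqrt hM.le]
  refine le_csSup hb ⟨fun z => ((1 / √M : ℝ) : ℂ) * f z, ⟨hf.1.const_mul _, ?_⟩, ?_, ?_⟩
  · simp_rw [hn, mul_assoc]
    exact hf.2.const_mul _
  · unfold normSq at hfM ⊢
    simp_rw [hn, mul_assoc]
    rw [integral_const_mul, one_div, inv_mul_le_iff₀ hM, mul_one]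
    exact hfM
  · simp only [hn]
    ring

theorem bergmanKernel_translate (φ : ℂ → ℝ) (a : ℂ) (r : ℝ) :
    bergmanKernel (Metric.ball a r) φ a
      = bergmanKernel (Metric.ball 0 r) (fun z => φ (a + z)) 0 := by
  have hpre : (fun z => a + z) ⁻¹' Metric.ball a r = Metric.ball 0 r := by
    ext z; simp [dist_eq_norm]
  have hpre' : (fun z => -a + z) ⁻¹' Metric.ball 0 r = Metric.ball a r := by
    ext z; simp [dist_eq_norm, neg_add_eq_sub]
  have hmp : MeasurePreserving (fun z : ℂ => a + z) volume volume :=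
    measurePreserving_add_left volume a
  have hemb : MeasurableEmbedding fun z : ℂ => a + z := measurableEmbedding_addLeft a
  have hint : ∀ f : ℂ → ℝ, ∫ z in Metric.ball a r, f z = ∫ z in Metric.ball 0 r, f (a + z) :=
    fun f => by rw [← hpre, hmp.setIntegral_preimage_emb hemb]
  have hio : ∀ f : ℂ → ℝ, IntegrableOn f (Metric.ball a r) ↔
      IntegrableOn (fun z => f (a + z)) (Metric.ball 0 r) := fun f => by
    rw [← hpre]; exact (hmp.integrableOn_comp_preimage hemb).symm
  unfold bergmanKernel
  congr 1
  ext t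
  constructor
  · rintro ⟨f, ⟨hf1, hf2⟩, hf3, rfl⟩
    refine ⟨fun z => f (a + z), ⟨hf1.comp (by fun_prop) (by rw [mapsTo_iff_subset_preimage, hpre]),
      (hio _).1 hf2⟩, ?_, by simp⟩
    unfold normSq at hf3 ⊢
    rwa [hint] at hf3
  · rintro ⟨f, ⟨hf1, hf2⟩, hf3, rfl⟩
    refine ⟨fun z => f (-a + z), ⟨hf1.comp (by fun_prop)
      (by rw [mapsTo_iff_subset_preimage, hpre']), (hio _).2 (by simpa using hf2)⟩, ?_, by simp⟩
    unfold normSq at hf3 ⊢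
    rw [hint]
    simpa using hf3

theorem extensionIndex_translate (φ : ℂ → ℝ) (a : ℂ) (r : ℝ) :
    extensionIndex φ a r = extensionIndex (fun z => φ (a + z)) 0 r := by
  rw [extensionIndex, extensionIndex, bergmanKernel_translate]

theorem leviCoeff_translate (φ : ℂ → ℝ) (a z : ℂ) :
    leviCoeff (fun w => φ (a + w)) z = leviCoeff φ (a + z) := by
  have h1 : (wirtingerBar fun w => (φ (a + w) : ℂ))
      = fun w => (wirtingerBar fun w => (φ w : ℂ)) (a + w) := by
    funext w
    simp only [wirtingerBar, fderiv_comp_add_left (f := fun w => (φ w : ℂ))]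
  rw [leviCoeff, h1]
  simp only [leviCoeff, wirtinger]
  rw [fderiv_comp_add_left (f := wirtingerBar fun w => (φ w : ℂ))]

end Kernel

/-! ### Second order expansion modulo real parts of holomorphic functions -/

section Taylor

variable {φ : ℂ → ℝ}

theorem leviCoeff_eq_fderiv_fderiv {a : ℂ} (hφ : ContDiffAt ℝ ∞ φ a) :
    leviCoeff φ a = (fderiv ℝ (fderiv ℝ φ) a 1 1
      + fderiv ℝ (fderiv ℝ φ) a Complex.I Complex.I) / 4 := by
  have hev : ∀ᶠ w in 𝓝 a, DifferentiableAt ℝ φ w := by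
    filter_upwards [(hφ.of_le (m := 1) (by simp)).eventually (by simp)] with w hw
    exact hw.differentiableAt (by simp)
  have hd2 : DifferentiableAt ℝ (fderiv ℝ φ) a :=
    (hφ.fderiv_right (m := 1) (by exact WithTop.coe_le_coe.2 le_top)).differentiableAt (by simp)
  have hdv : ∀ v : ℂ, DifferentiableAt ℝ (fun w => fderiv ℝ φ w v) a := fun v =>
    hd2.clm_apply (differentiableAt_const v)
  have h2 : ∀ u v : ℂ, fderiv ℝ (fun w => fderiv ℝ φ w v) a u = fderiv ℝ (fderiv ℝ φ) a u v := by
    intro u v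
    rw [fderiv_clm_apply hd2 (differentiableAt_const v)]
    simp
  have hdc : ∀ v : ℂ, DifferentiableAt ℝ (fun w => (fderiv ℝ φ w v : ℂ)) a := fun v =>
    Complex.ofRealCLM.differentiableAt.comp a (hdv v)
  have e1 : (wirtingerBar fun w => (φ w : ℂ)) =ᶠ[𝓝 a] fun w =>
      (1 / 2) * ((fderiv ℝ φ w 1 : ℂ) + Complex.I * (fderiv ℝ φ w Complex.I : ℂ)) := by
    filter_upwards [hev] with w hw
    rw [wirtingerBar, fderiv_ofReal_comp hw, fderiv_ofReal_comp hw]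
  have e2 : ∀ u, fderiv ℝ (fun w =>
      (1 / 2 : ℂ) * ((fderiv ℝ φ w 1 : ℂ) + Complex.I * (fderiv ℝ φ w Complex.I : ℂ))) a u
      = (1 / 2) * ((fderiv ℝ (fderiv ℝ φ) a u 1 : ℂ)
        + Complex.I * (fderiv ℝ (fderiv ℝ φ) a u Complex.I : ℂ)) := by
    intro u
    rw [fderiv_const_mul (DifferentiableAt.fun_add (hdc 1) ((hdc _).const_mul _)),
      fderiv_fun_add (hdc 1) ((hdc _).const_mul _), fderiv_const_mul (hdc _)]
    simp only [_root_.smul_apply, _root_.add_apply, smul_eq_mul]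
    rw [fderiv_ofReal_comp (hdv _), fderiv_ofReal_comp (hdv _), h2, h2]
  rw [leviCoeff, wirtinger_congr e1, wirtinger, e2, e2]
  simp
  ring

/-- Second order Taylor expansion, with the pluriharmonic part written as the real part of a
holomorphic function. -/
theorem exists_holomorphic_taylor (hφ : ContDiffAt ℝ ∞ φ 0) :
    ∃ H : ℂ → ℂ, Differentiable ℂ H ∧ (H 0).re = φ 0 ∧ ∀ η > 0, ∃ ρ > 0, ∀ z : ℂ, ‖z‖ < ρ →
      |φ z - (H z).re - leviCoeff φ 0 * ‖z‖ ^ 2| ≤ η * ‖z‖ ^ 2 := by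
  set D1 := fderiv ℝ φ 0 with hD1
  set D2 := fderiv ℝ (fderiv ℝ φ) 0 with hD2
  have hev : ∀ᶠ w in 𝓝 (0 : ℂ), DifferentiableAt ℝ φ w := by
    filter_upwards [(hφ.of_le (m := 1) (by simp)).eventually (by simp)] with w hw
    exact hw.differentiableAt (by simp)
  have hd2 : DifferentiableAt ℝ (fderiv ℝ φ) 0 :=
    (hφ.fderiv_right (m := 1) (by exact WithTop.coe_le_coe.2 le_top)).differentiableAt (by simp)
  have hsy : ∀ u v, D2 u v = D2 v u := fun u v => (hφ.isSymmSndFDerivAt (by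
    simp only [minSmoothness_of_isRCLikeNormedField]
    exact WithTop.coe_le_coe.2 (le_top : (2 : ℕ∞) ≤ ⊤))) u v
  have hlo := hd2.hasFDerivAt.isLittleO
  -- The z² coefficient carries the trace-free part of the Hessian; its trace part is the term
  -- λ|z|².
  refine ⟨fun z => (φ 0 : ℂ) + ((D1 1 : ℂ) - Complex.I * (D1 Complex.I : ℂ)) * z
      + (((D2 1 1 - D2 Complex.I Complex.I) / 4 : ℝ) - Complex.I * ((D2 1 Complex.I / 2 : ℝ) : ℂ))
        * z ^ 2, by fun_prop, by simp, fun η hη => ?_⟩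
  have hb := (hlo.def hη).and hev
  obtain ⟨ρ, hρ, hball⟩ := Metric.eventually_nhds_iff.1 hb
  refine ⟨ρ, hρ, fun z hz => ?_⟩
  set ψ : ℂ → ℝ := fun w => φ w - φ 0 - D1 w - (1 / 2) * D2 w w with hψ
  have hder : ∀ w ∈ Metric.closedBall (0 : ℂ) ‖z‖,
      HasFDerivAt ψ (fderiv ℝ φ w - D1 - D2 w) w := by
    intro w hw
    have hwρ : dist w 0 < ρ := by
      rw [Metric.mem_closedBall] at hw
      exact hw.trans_lt hz
    have h1 := (hball hwρ).2.hasFDerivAt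
    have h2 := (D2.hasFDerivAt (x := w)).clm_apply (hasFDerivAt_id (𝕜 := ℝ) w)
    have h3 := ((h1.sub_const (φ 0)).sub (D1.hasFDerivAt (x := w))).sub (h2.const_mul (1 / 2 : ℝ))
    have h4 : HasFDerivAt ψ _ w := h3
    refine h4.congr_fderiv (ContinuousLinearMap.ext fun u => ?_)
    simp only [_root_.sub_apply, _root_.smul_apply, _root_.add_apply, smul_eq_mul,
      ContinuousLinearMap.comp_apply, ContinuousLinearMap.flip_apply, ContinuousLinearMap.id_apply,
      id]
    rw [hsy u w]
    ring
  have hbound : ∀ w ∈ Metric.closedBall (0 : ℂ) ‖z‖, ‖fderiv ℝ φ w - D1 - D2 w‖ ≤ η * ‖z‖ := by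
    intro w hw
    rw [mem_closedBall_zero_iff] at hw
    have h1 := (hball (show dist w 0 < ρ by rw [dist_zero_right]; exact hw.trans_lt hz)).1
    simp only [sub_zero] at h1
    exact h1.trans (by gcongr)
  -- The differential of the remainder ψ is o(|w|), so the mean value inequality gives ψ = o(|z|²)
  -- without third derivatives.
  have hmv := (convex_closedBall (0 : ℂ) ‖z‖).norm_image_sub_le_of_norm_hasFDerivWithin_le
    (fun w hw => (hder w hw).hasFDerivWithinAt) hbound
    (x := 0) (y := z) (by simp) (by simp)
  have hψ0 : ψ 0 = 0 := by simp [hψ]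
  rw [hψ0, sub_zero, sub_zero, Real.norm_eq_abs, mul_assoc, ← pow_two] at hmv
  refine le_trans (le_of_eq ?_) hmv
  congr 1
  rw [leviCoeff_eq_fderiv_fderiv hφ, ← hD2]
  have hz1 : z = z.re • (1 : ℂ) + z.im • Complex.I := by
    apply Complex.ext <;> simp
  have hD1z : D1 z = z.re * D1 1 + z.im * D1 Complex.I := by
    conv_lhs => rw [hz1, map_add, map_smul, map_smul]
    simp
  have hD2z : D2 z z = z.re ^ 2 * D2 1 1 + 2 * z.re * z.im * D2 1 Complex.I
      + z.im ^ 2 * D2 Complex.I Complex.I := by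
    have : ∀ u, D2 z u = z.re * D2 1 u + z.im * D2 Complex.I u := fun u => by
      conv_lhs => rw [hz1, map_add, map_smul, map_smul]
      simp
    rw [this]
    have h5 : ∀ v, D2 v z = z.re * D2 v 1 + z.im * D2 v Complex.I := fun v => by
      conv_lhs => rw [hz1, map_add, map_smul, map_smul]
      simp
    rw [h5, h5, hsy Complex.I 1]
    ring
  simp only [hψ]
  rw [hD1z, hD2z, Complex.sq_norm, Complex.normSq_apply]
  simp [pow_two]
  ring

end Taylor

/-! ### Kernel bounds for weights close to Re H + k|z|² -/

section Asymptotics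

variable {φ : ℂ → ℝ} {H : ℂ → ℂ} {r k : ℝ}

theorem norm_exp_half_sq (w : ℂ) : ‖Complex.exp (w / 2)‖ ^ 2 = Real.exp w.re := by
  rw [Complex.norm_exp, ← Real.exp_nat_mul]
  congr 1
  simp
  ring

/-- Upper bound for the Bergman kernel of a weight bounded above by `Re H + k |z|²`. -/
theorem bergman_upper_bound (hr : 0 < r) (hk : k * r ^ 2 < 1) (hφc : ContinuousOn φ (Metric.closedBall 0 r))
    (hH : Differentiable ℂ H) (hH0 : (H 0).re = φ 0)
    (hle : ∀ z : ℂ, ‖z‖ < r → φ z - (H z).re ≤ k * ‖z‖ ^ 2) {f : ℂ → ℂ}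
    (hf : f ∈ bergmanSpace (Metric.ball 0 r) φ) (hf1 : normSq (Metric.ball 0 r) φ f ≤ 1) :
    ‖f 0‖ ^ 2 * Real.exp (-φ 0) ≤ 1 / (Real.pi * r ^ 2 * (1 - k * r ^ 2 / 2)) := by
  set F : ℂ → ℂ := fun z => f z * Complex.exp (-H z / 2) with hF
  have hFn : ∀ z, ‖F z‖ ^ 2 = ‖f z‖ ^ 2 * Real.exp (-(H z).re) := fun z => by
    rw [hF, norm_mul, mul_pow, norm_exp_half_sq, Complex.neg_re]
  have hFd : DifferentiableOn ℂ F (Metric.ball 0 r) :=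
    hf.1.mul ((hH.neg.div_const 2).cexp).differentiableOn
  have hm : MeasurableSet (Metric.ball (0 : ℂ) r) := measurableSet_ball
  have hcc : ContinuousOn (fun z => Real.exp (φ z - (H z).re)) (Metric.closedBall 0 r) :=
    (hφc.sub (Complex.continuous_re.comp hH.continuous).continuousOn).rexp
  obtain ⟨B, hB⟩ := (isCompact_closedBall (0 : ℂ) r).exists_bound_of_continuousOn hcc
  have hFe : ∀ z, ‖F z‖ ^ 2 = (‖f z‖ ^ 2 * Real.exp (-φ z)) * Real.exp (φ z - (H z).re) :=
    fun z => by
      rw [hFn, mul_assoc, ← Real.exp_add]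
      congr 2
      ring
  have hFi : IntegrableOn (fun z => ‖F z‖ ^ 2) (Metric.ball 0 r) := by
    simp_rw [hFe]
    refine Integrable.mul_bdd (c := B) hf.2
      ((hcc.mono Metric.ball_subset_closedBall).aestronglyMeasurable hm) ?_
    filter_upwards [ae_restrict_mem hm] with z hz
    exact hB z (Metric.ball_subset_closedBall hz)
  have hpos : ∀ t, 0 ≤ t → t < r → 0 ≤ 1 - k * t ^ 2 := by
    intro t ht htr
    have h1 : t ^ 2 ≤ r ^ 2 := by gcongr
    rcases le_total 0 k with h | h
    · nlinarith
    · nlinarith [sq_nonneg t]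
  -- The polynomial 1 - kt² replaces e^{-kt²}, which it bounds from below; the disc integral becomes
  -- explicit, and kr² < 1 keeps the weight nonnegative.
  have hmv := sub_mean_value_radial (W := fun t => 1 - k * t ^ 2) hFd hpos (by fun_prop) hFi
  have hvol := setIntegral_ball_quadratic (A := 1) (B := -k) hr
  have e1 : ∫ z in Metric.ball (0 : ℂ) r, (1 - k * ‖z‖ ^ 2)
      = Real.pi * r ^ 2 * (1 - k * r ^ 2 / 2) := by
    simp_rw [sub_eq_add_neg, ← neg_mul]
    rw [hvol]
    ring
  rw [e1] at hmv
  have hle1 : ∫ z in Metric.ball 0 r, ‖F z‖ ^ 2 * (1 - k * ‖z‖ ^ 2) ≤ 1 := by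
    refine le_trans (integral_mono_of_nonneg ?_ hf.2 ?_) hf1
    · filter_upwards [ae_restrict_mem hm] with z hz
      exact mul_nonneg (sq_nonneg _) (hpos _ (norm_nonneg _) (mem_ball_zero_iff.1 hz))
    · filter_upwards [ae_restrict_mem hm] with z hz
      rw [hFe, mul_assoc]
      refine mul_le_of_le_one_right (by positivity) ?_
      have h1 := hle z (mem_ball_zero_iff.1 hz)
      have h2 : 1 - k * ‖z‖ ^ 2 ≤ Real.exp (-(k * ‖z‖ ^ 2)) := by
        have := Real.add_one_le_exp (-(k * ‖z‖ ^ 2)); linarith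
      calc Real.exp (φ z - (H z).re) * (1 - k * ‖z‖ ^ 2)
          ≤ Real.exp (k * ‖z‖ ^ 2) * Real.exp (-(k * ‖z‖ ^ 2)) :=
            mul_le_mul (Real.exp_le_exp.2 h1) h2
              (hpos _ (norm_nonneg _) (mem_ball_zero_iff.1 hz)) (Real.exp_pos _).le
        _ = 1 := by rw [← Real.exp_add]; simp
  have h0 : ‖F 0‖ ^ 2 = ‖f 0‖ ^ 2 * Real.exp (-φ 0) := by rw [hFn, hH0]
  rw [h0] at hmv
  have hp : 0 < Real.pi * r ^ 2 * (1 - k * r ^ 2 / 2) := by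
    have : 0 < 1 - k * r ^ 2 / 2 := by linarith
    positivity
  rw [le_div_iff₀ hp]
  exact hmv.trans hle1

theorem bddAbove_bergman (hr : 0 < r) (hk : k * r ^ 2 < 1)
    (hφc : ContinuousOn φ (Metric.closedBall 0 r)) (hH : Differentiable ℂ H)
    (hH0 : (H 0).re = φ 0) (hle : ∀ z : ℂ, ‖z‖ < r → φ z - (H z).re ≤ k * ‖z‖ ^ 2) :
    BddAbove {t : ℝ | ∃ f ∈ bergmanSpace (Metric.ball 0 r) φ,
      normSq (Metric.ball 0 r) φ f ≤ 1 ∧ t = ‖f 0‖ ^ 2 * Real.exp (-φ 0)} := by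
  refine ⟨1 / (Real.pi * r ^ 2 * (1 - k * r ^ 2 / 2)), ?_⟩
  rintro t ⟨f, hf, hf1, rfl⟩
  exact bergman_upper_bound hr hk hφc hH hH0 hle hf hf1

theorem bergmanKernel_le (hr : 0 < r) (hk : k * r ^ 2 < 1)
    (hφc : ContinuousOn φ (Metric.closedBall 0 r)) (hH : Differentiable ℂ H)
    (hH0 : (H 0).re = φ 0) (hle : ∀ z : ℂ, ‖z‖ < r → φ z - (H z).re ≤ k * ‖z‖ ^ 2) :
    bergmanKernel (Metric.ball 0 r) φ 0 ≤ 1 / (Real.pi * r ^ 2 * (1 - k * r ^ 2 / 2)) := by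
  refine csSup_le ⟨_, 0, ⟨differentiableOn_const 0, by simp⟩, by simp [normSq], rfl⟩ ?_
  rintro t ⟨f, hf, hf1, rfl⟩
  exact bergman_upper_bound hr hk hφc hH hH0 hle hf hf1

/-- Lower bound for the Bergman kernel by the test function `e^{H/2}`. -/
theorem le_bergmanKernel_of_le (hr : 0 < r) (hφc : ContinuousOn φ (Metric.closedBall 0 r))
    (hb : BddAbove {t : ℝ | ∃ f ∈ bergmanSpace (Metric.ball 0 r) φ,
      normSq (Metric.ball 0 r) φ f ≤ 1 ∧ t = ‖f 0‖ ^ 2 * Real.exp (-φ 0)})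
    (hH : Differentiable ℂ H) (hH0 : (H 0).re = φ 0)
    (hle : ∀ z : ℂ, ‖z‖ < r → k * ‖z‖ ^ 2 ≤ φ z - (H z).re) (hk : 0 ≤ k) :
    1 / (Real.pi * r ^ 2 * (1 - k * r ^ 2 / 2 + k ^ 2 * r ^ 4 / 2))
      ≤ bergmanKernel (Metric.ball 0 r) φ 0 := by
  have hm : MeasurableSet (Metric.ball (0 : ℂ) r) := measurableSet_ball
  have hfin : IsFiniteMeasure (volume.restrict (Metric.ball (0 : ℂ) r)) :=
    ⟨by rw [Measure.restrict_apply_univ]; exact measure_ball_lt_top⟩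
  have he : ∀ z, ‖Complex.exp (H z / 2)‖ ^ 2 * Real.exp (-φ z) = Real.exp ((H z).re - φ z) :=
    fun z => by rw [norm_exp_half_sq, ← Real.exp_add, sub_eq_add_neg]
  have hpt : ∀ z : ℂ, ‖z‖ < r →
      Real.exp ((H z).re - φ z) ≤ 1 + k ^ 2 * r ^ 4 / 2 + -k * ‖z‖ ^ 2 := by
    intro z hz
    have h1 := hle z hz
    have h2 : 0 ≤ k * ‖z‖ ^ 2 := by positivity
    -- With x = k|z|², this follows from 1 + x + x²/2 ≤ eˣ and (1 - x + x²/2)(1 + x + x²/2) = 1 +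
    -- x⁴/4.
    have h3 : Real.exp (-(k * ‖z‖ ^ 2)) ≤ 1 - k * ‖z‖ ^ 2 + (k * ‖z‖ ^ 2) ^ 2 / 2 := by
      have h5 := Real.quadratic_le_exp_of_nonneg h2
      rw [Real.exp_neg]
      refine inv_le_of_inv_le₀ ?_ ?_
      · nlinarith [sq_nonneg (k * ‖z‖ ^ 2 - 1)]
      · refine le_trans ?_ h5
        rw [inv_le_iff_one_le_mul₀ (by nlinarith [sq_nonneg (k * ‖z‖ ^ 2 - 1)])]
        nlinarith [sq_nonneg ((k * ‖z‖ ^ 2) ^ 2)]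
    have h4 : (k * ‖z‖ ^ 2) ^ 2 ≤ k ^ 2 * r ^ 4 := by
      have : ‖z‖ ^ 4 ≤ r ^ 4 := by gcongr
      calc (k * ‖z‖ ^ 2) ^ 2 = k ^ 2 * ‖z‖ ^ 4 := by ring
        _ ≤ _ := by gcongr
    have h6 : Real.exp ((H z).re - φ z) ≤ Real.exp (-(k * ‖z‖ ^ 2)) :=
      Real.exp_le_exp.2 (by linarith)
    linarith
  have hcc : ContinuousOn (fun z => Real.exp ((H z).re - φ z)) (Metric.closedBall 0 r) :=
    ((Complex.continuous_re.comp hH.continuous).continuousOn.sub hφc).rexp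
  have hi : IntegrableOn (fun z => Real.exp ((H z).re - φ z)) (Metric.ball 0 r) :=
    (hcc.integrableOn_compact (isCompact_closedBall 0 r)).mono_set Metric.ball_subset_closedBall
  have hmem : (fun z => Complex.exp (H z / 2)) ∈ bergmanSpace (Metric.ball 0 r) φ := by
    refine ⟨((hH.div_const 2).cexp).differentiableOn, ?_⟩
    simp_rw [he]
    exact hi
  have hM : 0 < Real.pi * r ^ 2 * (1 - k * r ^ 2 / 2 + k ^ 2 * r ^ 4 / 2) := by
    have : 0 < 1 - k * r ^ 2 / 2 + k ^ 2 * r ^ 4 / 2 := by nlinarith [sq_nonneg (k * r ^ 2 - 1)]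
    positivity
  have hn : normSq (Metric.ball 0 r) φ (fun z => Complex.exp (H z / 2))
      ≤ Real.pi * r ^ 2 * (1 - k * r ^ 2 / 2 + k ^ 2 * r ^ 4 / 2) := by
    unfold normSq
    simp_rw [he]
    have hq := setIntegral_ball_quadratic (A := 1 + k ^ 2 * r ^ 4 / 2) (B := -k) hr
    calc _ ≤ ∫ z in Metric.ball (0 : ℂ) r, (1 + k ^ 2 * r ^ 4 / 2 + -k * ‖z‖ ^ 2) := by
          refine setIntegral_mono_on hi ?_ hm fun z hz => hpt z (mem_ball_zero_iff.1 hz)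
          exact (ContinuousOn.integrableOn_compact (isCompact_closedBall 0 r) (by fun_prop)).mono_set
            Metric.ball_subset_closedBall
      _ = _ := by rw [hq]; ring
  have h := le_bergmanKernel hb hmem hM hn
  rwa [he, hH0, sub_self, Real.exp_zero] at h

end Asymptotics

/-! ### The Ohsawa–Takegoshi estimate with optimal constant -/

section SharpExtension

/-- A function smooth on a ball agrees on a smaller ball with a compactly supported smooth
function on the plane. -/
theorem exists_contDiff_eqOn_ball {φ : ℂ → ℝ} {R R' : ℝ} (hR' : 0 < R') (hR : R' < R)
    (hφ : ContDiffOn ℝ ∞ φ (Metric.ball 0 R)) :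
    ∃ ψ : ℂ → ℝ, ContDiff ℝ ∞ ψ ∧ HasCompactSupport ψ ∧ EqOn ψ φ (Metric.ball 0 R') := by
  let χ : ContDiffBump (0 : ℂ) := ⟨R', (R' + R) / 2, hR', by linarith⟩
  have hsub : tsupport χ ⊆ Metric.ball 0 R := by
    rw [χ.tsupport_eq]
    exact Metric.closedBall_subset_ball (show (R' + R) / 2 < R by linarith)
  refine ⟨fun z => χ z * φ z, ?_, χ.hasCompactSupport.mul_right, fun z hz => ?_⟩
  · rw [contDiff_iff_contDiffAt]
    intro z
    by_cases hz : z ∈ tsupport χ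
    · exact χ.contDiff.contDiffAt.mul (hφ.contDiffAt (Metric.isOpen_ball.mem_nhds (hsub hz)))
    · refine (contDiffAt_const (c := (0 : ℝ))).congr_of_eventuallyEq ?_
      filter_upwards [notMem_tsupport_iff_eventuallyEq.1 hz] with w hw
      simp [hw]
  · have h1 : χ z = 1 := χ.one_of_mem_closedBall (Metric.ball_subset_closedBall hz)
    simp [h1]

theorem leviCoeff_congr {φ ψ : ℂ → ℝ} {z : ℂ} (h : φ =ᶠ[𝓝 z] ψ) :
    leviCoeff φ z = leviCoeff ψ z := by
  have h1 : (fun w => (φ w : ℂ)) =ᶠ[𝓝 z] fun w => (ψ w : ℂ) := by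
    filter_upwards [h] with w hw
    rw [hw]
  have h2 : (wirtingerBar fun w => (φ w : ℂ)) =ᶠ[𝓝 z] wirtingerBar fun w => (ψ w : ℂ) := by
    filter_upwards [h1.eventuallyEq_nhds] with w hw
    exact wirtingerBar_congr hw
  rw [leviCoeff, leviCoeff, wirtinger_congr h2]

/-- The sharp Ohsawa–Takegoshi estimate for a point in a disc. -/
theorem sharp_extension {φ : ℂ → ℝ} {r R : ℝ} (hr : 0 < r) (hrR : r < R)
    (hφ : ContDiffOn ℝ ∞ φ (Metric.ball 0 R))
    (hsub : ∀ z ∈ Metric.ball (0 : ℂ) R, 0 ≤ leviCoeff φ z)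
    (hb : BddAbove {t : ℝ | ∃ f ∈ bergmanSpace (Metric.ball 0 r) φ,
      normSq (Metric.ball 0 r) φ f ≤ 1 ∧ t = ‖f 0‖ ^ 2 * Real.exp (-φ 0)}) :
    1 / (Real.pi * r ^ 2) ≤ bergmanKernel (Metric.ball 0 r) φ 0 := by
  obtain ⟨R', hrR', hR'R⟩ := exists_between hrR
  obtain ⟨ψ, hψ, hψc, hψe⟩ := exists_contDiff_eqOn_ball (hr.trans hrR') hR'R hφ
  have hψsub : ∀ z ∈ Metric.ball (0 : ℂ) R', 0 ≤ leviCoeff ψ z := by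
    intro z hz
    rw [leviCoeff_congr (hψe.eventuallyEq_of_mem (Metric.isOpen_ball.mem_nhds hz))]
    exact hsub z (Metric.ball_subset_ball hR'R.le hz)
  have hball : ∀ z ∈ Metric.ball (0 : ℂ) r, ψ z = φ z := fun z hz =>
    hψe (Metric.ball_subset_ball hrR'.le hz)
  have h0 : ψ 0 = φ 0 := hball 0 (Metric.mem_ball_self hr)
  -- The radius rt costs t² and the smoothing factor η = t costs one more; letting t → 1 recovers
  -- the sharp constant.
  have key : ∀ t : ℝ, 1 < t → t < R' / r →
      1 / (Real.pi * r ^ 2 * t ^ 3) ≤ bergmanKernel (Metric.ball 0 r) φ 0 := by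
    intro t ht htR
    have htr : r * t < R' := by rw [lt_div_iff₀ hr] at htR; linarith
    obtain ⟨f, hf, N, hfN, hfn, hN⟩ := exists_mem_bergmanSpace_of_subharmonic hr
      (show r < r * t by nlinarith) ht hψ hψc
      fun z hz => hψsub z (Metric.ball_subset_ball htr.le hz)
    have hpi := Real.pi_pos
    have hN0 : 0 < N := lt_of_lt_of_le (by positivity) hN
    have hfm : f ∈ bergmanSpace (Metric.ball 0 r) φ := by
      refine ⟨hf.1, hf.2.congr_fun (fun z hz => ?_) measurableSet_ball⟩
      simp only [hball z hz]
    have hfn' : normSq (Metric.ball 0 r) φ f ≤ t * N := by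
      refine le_trans (le_of_eq ?_) hfn
      refine setIntegral_congr_fun measurableSet_ball fun z hz => ?_
      simp only [hball z hz]
    have h := le_bergmanKernel hb hfm (show 0 < t * N by positivity) hfn'
    refine le_trans ?_ h
    rw [hfN, Complex.norm_real, Real.norm_of_nonneg hN0.le, ← h0, Real.exp_neg]
    have e : N ^ 2 * (Real.exp (ψ 0))⁻¹ / (t * N) = N * (Real.exp (ψ 0))⁻¹ / t := by
      field_simp
    rw [e, le_div_iff₀ (by linarith), ← div_eq_mul_inv, le_div_iff₀ (Real.exp_pos _)]
    refine le_trans (le_of_eq ?_) hN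
    field_simp
  have hlim : Tendsto (fun t : ℝ => 1 / (Real.pi * r ^ 2 * t ^ 3)) (𝓝[>] 1)
      (𝓝 (1 / (Real.pi * r ^ 2))) := by
    have hc : ContinuousAt (fun t : ℝ => 1 / (Real.pi * r ^ 2 * t ^ 3)) 1 := by
      refine ContinuousAt.div continuousAt_const (by fun_prop) ?_
      positivity
    have := hc.tendsto
    simp only [one_pow, mul_one] at this
    exact this.mono_left nhdsWithin_le_nhds
  refine le_of_tendsto hlim ?_
  have h1 : 1 < R' / r := (one_lt_div hr).2 hrR'
  filter_upwards [Ioo_mem_nhdsGT h1] with t ht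
  exact key t ht.1 ht.2

end SharpExtension

/-! ### The extension index on small discs -/

section ExtensionIndex

variable {φ : ℂ → ℝ} {R : ℝ}

/-- Small discs satisfy the hypotheses of `bergman_upper_bound` for every `k > leviCoeff φ 0`. -/
theorem exists_radius_upper (hR : 0 < R) (hφ : ContDiffOn ℝ ∞ φ (Metric.ball 0 R)) {k : ℝ}
    (hk : leviCoeff φ 0 < k) :
    ∃ ρ > 0, ∀ r, 0 < r → r < ρ →
      BddAbove {t : ℝ | ∃ f ∈ bergmanSpace (Metric.ball 0 r) φ,
        normSq (Metric.ball 0 r) φ f ≤ 1 ∧ t = ‖f 0‖ ^ 2 * Real.exp (-φ 0)} ∧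
      ContinuousOn φ (Metric.closedBall 0 r) ∧ 0 < bergmanKernel (Metric.ball 0 r) φ 0 ∧
      1 - k * r ^ 2 / 2 ≤ extensionIndex φ 0 r := by
  obtain ⟨H, hH, hH0, hT⟩ := exists_holomorphic_taylor
    (hφ.contDiffAt (Metric.ball_mem_nhds 0 hR))
  obtain ⟨ρ, hρ, hTρ⟩ := hT (k - leviCoeff φ 0) (by linarith)
  refine ⟨min (min ρ R) (min 1 (1 / (|k| + 1))), by positivity, fun r hr hrρ => ?_⟩
  simp only [lt_min_iff] at hrρ
  obtain ⟨⟨h1, h2⟩, h3, h4⟩ := hrρ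
  have hk' : k * r ^ 2 < 1 := by
    rw [lt_div_iff₀ (by positivity)] at h4
    have : k * r ^ 2 ≤ |k| * r := by
      calc k * r ^ 2 ≤ |k| * r ^ 2 := by gcongr; exact le_abs_self k
        _ ≤ |k| * r := by gcongr; nlinarith
    nlinarith
  have hc : ContinuousOn φ (Metric.closedBall 0 r) :=
    hφ.continuousOn.mono (Metric.closedBall_subset_ball h2)
  have hle : ∀ z : ℂ, ‖z‖ < r → φ z - (H z).re ≤ k * ‖z‖ ^ 2 := by
    intro z hz
    have := (abs_le.1 (hTρ z (hz.trans h1))).2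
    linarith
  have hbdd := bddAbove_bergman hr hk' hc hH hH0 hle
  have hKle := bergmanKernel_le hr hk' hc hH hH0 hle
  -- Positivity is needed to invert the kernel bound. The constant 1 is the competitor, with its
  -- norm enlarged by 1 to have a positive bound at once.
  have hKpos : 0 < bergmanKernel (Metric.ball 0 r) φ 0 := by
    have hmem : (fun _ => (1 : ℂ)) ∈ bergmanSpace (Metric.ball 0 r) φ := by
      refine ⟨differentiableOn_const 1, ?_⟩
      exact ((continuousOn_const.mul hc.neg.rexp).integrableOn_compact
        (isCompact_closedBall 0 r)).mono_set Metric.ball_subset_closedBall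
    have hnn : 0 ≤ normSq (Metric.ball 0 r) φ fun _ => (1 : ℂ) :=
      integral_nonneg fun z => by positivity
    refine lt_of_lt_of_le ?_ (le_bergmanKernel hbdd hmem
      (show 0 < normSq (Metric.ball 0 r) φ (fun _ => (1 : ℂ)) + 1 by linarith) (by linarith))
    simp only [norm_one]
    positivity
  refine ⟨hbdd, hc, hKpos, ?_⟩
  have hp : 0 < 1 - k * r ^ 2 / 2 := by linarith
  have hpi := Real.pi_pos
  rw [extensionIndex, le_div_iff₀ (by positivity)]
  rw [le_div_iff₀ (by positivity)] at hKle
  linarith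

theorem exists_radius_lower (hR : 0 < R) (hφ : ContDiffOn ℝ ∞ φ (Metric.ball 0 R)) {k : ℝ}
    (hk0 : 0 < k) (hk : k < leviCoeff φ 0) :
    ∃ ρ > 0, ∀ r, 0 < r → r < ρ →
      extensionIndex φ 0 r ≤ Real.exp (-(k / 2 - k ^ 2 * r ^ 2 / 2) * r ^ 2) := by
  obtain ⟨ρ₁, hρ₁, hup⟩ := exists_radius_upper hR hφ (lt_add_one (leviCoeff φ 0))
  obtain ⟨H, hH, hH0, hT⟩ := exists_holomorphic_taylor
    (hφ.contDiffAt (Metric.ball_mem_nhds 0 hR))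
  obtain ⟨ρ, hρ, hTρ⟩ := hT (leviCoeff φ 0 - k) (by linarith)
  refine ⟨min ρ ρ₁, lt_min hρ hρ₁, fun r hr hrρ => ?_⟩
  rw [lt_min_iff] at hrρ
  obtain ⟨hb, hc, hK, _⟩ := hup r hr hrρ.2
  have hle : ∀ z : ℂ, ‖z‖ < r → k * ‖z‖ ^ 2 ≤ φ z - (H z).re := by
    intro z hz
    have := (abs_le.1 (hTρ z (hz.trans hrρ.1))).1
    linarith
  have h := le_bergmanKernel_of_le hr hc hb hH hH0 hle hk0.le
  have hpi := Real.pi_pos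
  have hM : 0 < 1 - k * r ^ 2 / 2 + k ^ 2 * r ^ 4 / 2 := by nlinarith [sq_nonneg (k * r ^ 2 - 1)]
  have hX : extensionIndex φ 0 r ≤ 1 - k * r ^ 2 / 2 + k ^ 2 * r ^ 4 / 2 := by
    rw [extensionIndex, div_le_iff₀ (by positivity)]
    rw [div_le_iff₀ (by positivity)] at h
    linarith
  have he := Real.add_one_le_exp (-(k / 2 - k ^ 2 * r ^ 2 / 2) * r ^ 2)
  have e : -(k / 2 - k ^ 2 * r ^ 2 / 2) * r ^ 2 + 1 = 1 - k * r ^ 2 / 2 + k ^ 2 * r ^ 4 / 2 := by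
    ring
  linarith

theorem exists_radius_subharmonic (hR : 0 < R) (hφ : ContDiffOn ℝ ∞ φ (Metric.ball 0 R))
    (hsub : ∀ z ∈ Metric.ball (0 : ℂ) R, 0 ≤ leviCoeff φ z) :
    ∃ ρ > 0, ∀ r, 0 < r → r < ρ → extensionIndex φ 0 r ≤ 1 := by
  obtain ⟨ρ, hρ, hup⟩ := exists_radius_upper hR hφ (lt_add_one (leviCoeff φ 0))
  refine ⟨min ρ R, lt_min hρ hR, fun r hr hrρ => ?_⟩
  rw [lt_min_iff] at hrρ
  obtain ⟨hb, _, hK, _⟩ := hup r hr hrρ.1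
  have h := sharp_extension hr hrρ.2 hφ hsub hb
  have hpi := Real.pi_pos
  rw [extensionIndex, div_le_iff₀ (by positivity)]
  rw [div_le_iff₀ (by positivity)] at h
  linarith

end ExtensionIndex

/-! ### Comparing the sharp estimate with the curvature bound -/

section SharpEstimate

variable {Ω : Set ℂ} {φ : ℂ → ℝ} {a : ℂ} {c : ℝ}

theorem contDiffOn_translate {R : ℝ} (hR : Metric.ball a R ⊆ Ω) (hφ : ContDiffOn ℝ ∞ φ Ω) :
    ContDiffOn ℝ ∞ (fun z => φ (a + z)) (Metric.ball 0 R) :=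
  hφ.comp (contDiff_const.add contDiff_id).contDiffOn fun z hz => hR (by simpa using hz)

/-- Boundedness of Ω makes `maxRadius` a genuine supremum; for an unbounded set of radii `sSup`
would be 0. -/
theorem le_maxRadius (hbdd : Bornology.IsBounded Ω) {R : ℝ} (hR : 0 < R)
    (h : Metric.ball a R ⊆ Ω) : R ≤ maxRadius Ω a := by
  refine le_csSup ?_ ⟨hR, h⟩
  obtain ⟨M, hM⟩ := hbdd.subset_closedBall a
  refine ⟨M, ?_⟩
  rintro r ⟨hr, hrΩ⟩
  refine le_of_forall_lt_imp_le_of_dense fun s hs => ?_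
  by_cases hs0 : s ≤ 0
  · have : a ∈ Metric.closedBall a M := hM (hrΩ (Metric.mem_ball_self hr))
    rw [Metric.mem_closedBall, dist_self] at this
    linarith
  · have hs1 : 0 < s := not_le.1 hs0
    have : a + s ∈ Metric.closedBall a M := hM (hrΩ (by
      simp [abs_of_pos hs1, hs]))
    simpa [abs_of_pos hs1] using this

theorem curvatureGE_of_sharpEstimate (hopen : IsOpen Ω) (hφ : ContDiffOn ℝ ∞ φ Ω) (ha : a ∈ Ω)
    (h : SharpEstimate Ω φ a c) : CurvatureGE φ a c := by
  rw [CurvatureGE]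
  by_contra! hlt
  obtain ⟨R, hR, hRΩ⟩ := Metric.isOpen_iff.1 hopen a ha
  have hl : leviCoeff (fun z => φ (a + z)) 0 = leviCoeff φ a := by
    rw [leviCoeff_translate, add_zero]
  -- A third of the gap: one part puts k above the curvature, one is the ε of the estimate, and the
  -- last leaves m ≥ k/2 + ε/2. As r → 0 this contradicts 1 - kr²/2 ≤ e^{-mr²}.
  set ε := (c - leviCoeff φ a) / 3 with hε
  have hε0 : 0 < ε := by rw [hε]; linarith
  set k := leviCoeff φ a + ε with hk
  set m := max ((c - ε) / 2) 0 with hm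
  have hm0 : 0 ≤ m := le_max_right _ _
  have hmk : k / 2 + ε / 2 ≤ m := le_trans (by rw [hk, hε]; linarith) (le_max_left _ _)
  obtain ⟨ρ, hρ, hup⟩ := exists_radius_upper hR (contDiffOn_translate hRΩ hφ) (k := k)
    (by rw [hl]; linarith)
  obtain ⟨rε, hrε, hest⟩ := h ε hε0
  set B := |k| * m + 1 with hB
  have hB0 : 0 < B := by positivity
  obtain ⟨r, hr0, hr⟩ := exists_between
    (show 0 < min (min ρ rε) (min 1 (ε / B)) from
      lt_min (lt_min hρ hrε.1) (lt_min one_pos (by positivity)))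
  simp only [lt_min_iff] at hr
  obtain ⟨⟨h1, h2⟩, h3, h4⟩ := hr
  have hlow := (hup r hr0 h1).2.2.2
  rw [← extensionIndex_translate] at hlow
  have hhigh := hest r ⟨hr0, h2⟩
  have hexp : Real.exp (-m * r ^ 2) * (1 + m * r ^ 2) ≤ 1 := by
    have h5 := Real.add_one_le_exp (m * r ^ 2)
    calc Real.exp (-m * r ^ 2) * (1 + m * r ^ 2)
        ≤ Real.exp (-m * r ^ 2) * Real.exp (m * r ^ 2) := by gcongr; linarith
      _ = 1 := by rw [← Real.exp_add]; simp
  -- Expanded, this says m - k/2 ≤ kmr²/2, and r was chosen so that the right side is below ε/2.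
  have hmul : (1 - k * r ^ 2 / 2) * (1 + m * r ^ 2) ≤ 1 :=
    le_trans (mul_le_mul_of_nonneg_right (hlow.trans hhigh) (by positivity)) hexp
  rw [lt_div_iff₀ hB0] at h4
  have hkm : k * m * r ^ 2 < ε := by
    have hkm' : k * m ≤ |k| * m := by gcongr; exact le_abs_self k
    have hr2 : r ^ 2 ≤ r := by nlinarith
    calc k * m * r ^ 2 ≤ |k| * m * r ^ 2 := by gcongr
      _ ≤ |k| * m * r := by gcongr
      _ < ε := by rw [hB] at h4; nlinarith
  have hr2 : 0 < r ^ 2 := by positivity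
  nlinarith

theorem sharpEstimate_of_curvatureGE (hopen : IsOpen Ω) (hbdd : Bornology.IsBounded Ω)
    (hφ : ContDiffOn ℝ ∞ φ Ω) (ha : a ∈ Ω) (hc : 0 ≤ c)
    (hac : 0 < c ∨ ∀ᶠ z in 𝓝 a, CurvatureGE φ z 0) (h : CurvatureGE φ a c) :
    SharpEstimate Ω φ a c := by
  intro ε hε
  obtain ⟨R, hR, hRΩ⟩ := Metric.isOpen_iff.1 hopen a ha
  have hmax := le_maxRadius hbdd hR hRΩ
  have hφ' := contDiffOn_translate hRΩ hφ
  have hl : leviCoeff (fun z => φ (a + z)) 0 = leviCoeff φ a := by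
    rw [leviCoeff_translate, add_zero]
  rw [CurvatureGE] at h
  suffices hs : ∃ ρ > 0, ∀ r, 0 < r → r < ρ → extensionIndex (fun z => φ (a + z)) 0 r
      ≤ Real.exp (-(max ((c - ε) / 2) 0) * r ^ 2) by
    obtain ⟨ρ, hρ, hest⟩ := hs
    refine ⟨min ρ (R / 2), ⟨by positivity, (min_le_right _ _).trans_lt (by linarith)⟩,
      fun r hr => ?_⟩
    rw [extensionIndex_translate]
    exact hest r hr.1 (hr.2.trans_le (min_le_left _ _))
  -- For c = 0 the required bound is L ≤ 1, supplied by subharmonicity; for c > 0 the asymptotic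
  -- expansion suffices.
  rcases hc.eq_or_lt with rfl | hc0
  · have hsub := hac.resolve_left (lt_irrefl _)
    obtain ⟨R', hR', hball⟩ := Metric.eventually_nhds_iff_ball.1 hsub
    have hR1 : Metric.ball a (min R R') ⊆ Ω :=
      (Metric.ball_subset_ball (min_le_left _ _)).trans hRΩ
    obtain ⟨ρ, hρ, hest⟩ := exists_radius_subharmonic (lt_min hR hR')
      (contDiffOn_translate hR1 hφ) fun z hz => by
        rw [leviCoeff_translate]
        refine hball _ ?_
        rw [mem_ball_zero_iff, lt_min_iff] at hz
        simpa using hz.2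
    refine ⟨ρ, hρ, fun r hr hrρ => (hest r hr hrρ).trans (le_of_eq ?_)⟩
    rw [max_eq_right (by linarith)]
    simp
  · set l := leviCoeff φ a with hl0
    set m := max ((c - ε) / 2) 0 with hm
    have hml : m < l / 2 := max_lt (by linarith) (by linarith)
    have hm0 : 0 ≤ m := le_max_right _ _
    -- The midpoint of 2m and l: k < l makes the expansion applicable, and k/2 > m leaves room for
    -- the error k²r²/2.
    set k := l / 2 + m with hk
    have hk0 : 0 < k := by linarith
    obtain ⟨ρ, hρ, hest⟩ := exists_radius_lower hR hφ' (k := k) hk0 (by rw [hl]; linarith)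
    refine ⟨min ρ (min 1 ((k / 2 - m) / k ^ 2)), lt_min hρ (lt_min one_pos
      (div_pos (by rw [hk]; linarith) (by positivity))), fun r hr hrρ => ?_⟩
    simp only [lt_min_iff] at hrρ
    obtain ⟨h1, h2, h3⟩ := hrρ
    refine (hest r hr h1).trans (Real.exp_le_exp.2 ?_)
    rw [lt_div_iff₀ (by positivity)] at h3
    have h4 : k ^ 2 * r ^ 2 ≤ k ^ 2 * r := by gcongr; nlinarith
    have h5 : 0 ≤ k ^ 2 * r := by positivity
    gcongr
    linarith

end SharpEstimate

end L2Ext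

end

theorem mainTheorem7 (Ω : Set ℂ) (hopen : IsOpen Ω) (hconn : IsConnected Ω)
    (hbdd : Bornology.IsBounded Ω)
    (φ : ℂ → ℝ) (hφ : ContDiffOn ℝ ∞ φ Ω)
    (g : ℂ → ℝ) (hg : ∀ z ∈ Ω, 0 ≤ g z) :
    (∀ a ∈ Ω, L2Ext.SharpEstimate Ω φ a (g a) → L2Ext.CurvatureGE φ a (g a)) ∧
    (∀ a ∈ Ω, (0 < g a ∨ ∀ᶠ z in 𝓝 a, L2Ext.CurvatureGE φ z 0) →
      (L2Ext.CurvatureGE φ a (g a) ↔ L2Ext.SharpEstimate Ω φ a (g a))) ∧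
    ((∀ a ∈ Ω, L2Ext.CurvatureGE φ a (g a)) ↔
      ∀ a ∈ Ω, L2Ext.SharpEstimate Ω φ a (g a)) := by
  have h1 : ∀ a ∈ Ω, L2Ext.SharpEstimate Ω φ a (g a) → L2Ext.CurvatureGE φ a (g a) :=
    fun a ha => L2Ext.curvatureGE_of_sharpEstimate hopen hφ ha
  refine ⟨h1, fun a ha hga => ⟨L2Ext.sharpEstimate_of_curvatureGE hopen hbdd hφ ha (hg a ha) hga,
    h1 a ha⟩, fun h a ha => ?_, fun h a ha => h1 a ha (h a ha)⟩
  -- The curvature bound at every point of the open set, together with g ≥ 0, gives subharmonicity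
  -- near `a`.
  refine L2Ext.sharpEstimate_of_curvatureGE hopen hbdd hφ ha (hg a ha) (Or.inr ?_) (h a ha)
  filter_upwards [hopen.mem_nhds ha] with z hz
  exact (hg z hz).trans (h z hz)
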